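/- Let $M$ be a von Neumann algebra with a faithful normal finite trace $\tau$, let $x\mapsto x\Omega_\tau$ be the canonical map $M\to L_2(M)=L_2(M,\tau)$, and let $(\Phi_t)_{t\ge 0}$ be a quantum Markov semi-group on $(M,\tau)$: a semi-group of unital completely positive maps with $\tau\circ\Phi_t=\tau$, $\tau(\Phi_t(x)y)=\tau(x\Phi_t(y))$, and $t\mapsto\Phi_t(x)$ strongly continuous for every $x\in M$. Let $\Delta\ge 0$ be the generator of the semi-group $x\Omega_\tau\mapsto\Phi_t(x)\Omega_\tau$ on $L_2(M)$, so that $\Phi_t^{(2)}=e^{-t\Delta}$. Let $\mathcal A\subseteq M$ be a $\sigma$-weakly dense $\ast$-subalgebra with $\mathcal A\Omega_\tau\subseteq\mathrm{dom}(\Delta)$, $\Delta(\mathcal A\Omega_\tau)\subseteq\mathcal A\Omega_\tau$, and $t\mapsto\Phi_t(a)$ norm continuous for all $a\in\mathcal A$. Write $\Delta(a)\in\mathcal A$ for the element with $\Delta(a)\Omega_\tau=\Delta(a\Omega_\tau)$, let $A$ be the norm closure of $\mathcal A$, and put $$\Gamma(x,y)=\tfrac12\big(\Delta(y)^*x+y^*\Delta(x)-\Delta(y^*x)\big),\qquad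 x,y\in\mathcal A.$$ An $A$-$A$-bimodule is a Hilbert space $H$ with commuting $\ast$-homomorphisms of $A$ and $A^{\mathrm{op}}$ into $B(H)$. For such $H$, the gradient tensor product $H_\nabla$ is the Hilbert space obtained from $\mathcal A\otimes_{\mathrm{alg}}H$ with the degenerate inner product $\langle x\otimes\xi,y\otimes\eta\rangle=\langle\Gamma(x,y)\xi,\eta\rangle$ (linear in the first variable) by dividing out the degenerate part and completing; $a\otimes_\nabla\xi$ is the class of $a\otimes\xi$, and the bimodule structure is determined by $$x\cdot(y\otimes_\nabla\xi)=xy\otimes_\nabla\xi-x\otimes_\nabla y\xi,\qquad (y\otimes_\nabla\xi)\cdot x=y\otimes_\nabla\xi x,\qquad x,y\in\mathcal A .$$ Let $L_2(M)_{\nabla^{(0)}}=L_2(M)$ be the trivial bimodule, and $L_2(M)_{\nabla^{(n+1)}}=(L_2(M)_{\nabla^{(n)}})_\nabla$. Then all $L_2(M)_{\nabla^{(n)}}$ are well-defined $A$-$A$-bimodules (the forms are positive semidefinite, and the formulas above define commuting actions of $\mathcal A$ that extend to $\ast$-homomorphisms on $A$ and $A^{\mathrm{op}}$), and for every $n\ge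 0$ the $n$-linear map $$\partial_n(a_1\otimes\cdots\otimes a_n)=a_1\otimes_\nabla\cdots\otimes_\nabla a_n\otimes_\nabla\Omega_\tau\in L_2(M)_{\nabla^{(n)}},\qquad \partial_0=\Omega_\tau,$$ is a Hochschild $n$-cocycle of $\mathcal A$: for all $a_1,\dots,a_{n+1}\in\mathcal A$, $$a_1\cdot\partial_n(a_2\otimes\cdots\otimes a_{n+1})+\sum_{k=1}^n(-1)^k\partial_n(a_1\otimes\cdots\otimes a_ka_{k+1}\otimes\cdots\otimes a_{n+1})+(-1)^{n+1}\partial_n(a_1\otimes\cdots\otimes a_n)\cdot a_{n+1}=0 .$$ For $n=1$, $\partial_1(a)=a\otimes_\nabla\Omega_\tau$ is the Cipriani–Sauvageot derivation into $L_2(M)_\nabla$: $\partial_1(ab)=a\cdot\partial_1(b)+\partial_1(a)\cdot b$ and $\langle\partial_1(a),\partial_1(b)\rangle=\langle a\Omega_\tau,\Delta(b)\Omega_\tau\rangle$ for all $a,b\in\mathcal A$, and $a\Omega_\tau\mapsto\partial_1(a)$ is closable: if $a_k\Omega_\tau\to0$ and $\partial_1(a_k)\to\eta$, then $\eta=0$.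 -/

import Mathlib

open scoped TensorProduct InnerProductSpace ComplexOrder NNReal Topology

noncomputable section

namespace GradientCocycle

universe u

/-! ### Hilbert space completion of a positive sesquilinear form

Forms are conjugate-linear in the first and linear in the second variable, as in Mathlib. -/

section Form

variable {V : Type u} [AddCommGroup V] [Module ℂ V]

theorem isSymm_of_nonneg (B : V →ₗ⋆[ℂ] V →ₗ[ℂ] ℂ) (hB : ∀ v, 0 ≤ B v v) (x y : V) :
    (starRingEnd ℂ) (B y x) = B x y := by
  have him : ∀ v, (B v v).im = 0 := fun v => ((Complex.le_def.1 (hB v)).2).symm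
  have h1 := him (x + y)
  have h2 := him (x + Complex.I • y)
  have hx := him x
  have hy := him y
  simp only [map_add, LinearMap.add_apply, map_smul, LinearMap.map_smulₛₗ, LinearMap.smul_apply,
    smul_eq_mul, Complex.conj_I, Complex.add_im, Complex.add_re, Complex.mul_im, Complex.mul_re, Complex.neg_im,
    Complex.neg_re, Complex.I_re, Complex.I_im] at h1 h2
  apply Complex.ext
  · simp only [Complex.conj_re]; linarith
  · simp only [Complex.conj_im]; linarith

open Classical in
/-- `B` itself if `B` is positive semidefinite (every form used below is), and `0` otherwise. -/
def psdForm (B : V →ₗ⋆[ℂ] V →ₗ[ℂ] ℂ) : V →ₗ⋆[ℂ] V →ₗ[ℂ] ℂ :=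
  if ∀ v, 0 ≤ B v v then B else 0

theorem psdForm_eq {B : V →ₗ⋆[ℂ] V →ₗ[ℂ] ℂ} (h : ∀ v, 0 ≤ B v v) : psdForm B = B := if_pos h

theorem psdForm_nonneg (B : V →ₗ⋆[ℂ] V →ₗ[ℂ] ℂ) (v : V) : 0 ≤ psdForm B v v := by
  unfold psdForm
  split_ifs with h
  · exact h v
  · simp

/-- `V` with the (degenerate) inner product given by `B`. -/
@[nolint unusedArguments]
def PreHilb (_B : V →ₗ⋆[ℂ] V →ₗ[ℂ] ℂ) : Type u := V

instance (B : V →ₗ⋆[ℂ] V →ₗ[ℂ] ℂ) : AddCommGroup (PreHilb B) := inferInstanceAs (AddCommGroup V)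
instance (B : V →ₗ⋆[ℂ] V →ₗ[ℂ] ℂ) : Module ℂ (PreHilb B) := inferInstanceAs (Module ℂ V)

/-- The identity map `V → PreHilb B`. -/
def toPre (B : V →ₗ⋆[ℂ] V →ₗ[ℂ] ℂ) : V ≃ₗ[ℂ] PreHilb B := LinearEquiv.refl ℂ V

/-- The (degenerate) inner product on `PreHilb B`. -/
abbrev preCore (B : V →ₗ⋆[ℂ] V →ₗ[ℂ] ℂ) : PreInnerProductSpace.Core ℂ (PreHilb B) where
  inner x y := psdForm B ((toPre B).symm x) ((toPre B).symm y)
  conj_inner_symm x y := isSymm_of_nonneg _ (psdForm_nonneg B) _ _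
  re_inner_nonneg x := (Complex.le_def.1 (psdForm_nonneg B _)).1
  add_left x y z := by simp
  smul_left x y r := by simp

instance (B : V →ₗ⋆[ℂ] V →ₗ[ℂ] ℂ) : SeminormedAddCommGroup (PreHilb B) :=
  InnerProductSpace.Core.toSeminormedAddCommGroup (c := preCore B)
instance (B : V →ₗ⋆[ℂ] V →ₗ[ℂ] ℂ) : InnerProductSpace ℂ (PreHilb B) :=
  InnerProductSpace.ofCore (preCore B)

/-- The Hilbert space obtained from `V` by dividing out the degenerate part of `B` and completing
(the uniform completion is Hausdorff, so that it does both). -/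
abbrev Hilb (B : V →ₗ⋆[ℂ] V →ₗ[ℂ] ℂ) : Type u := UniformSpace.Completion (PreHilb B)

/-- The canonical map `V → Hilb B`, with dense range. -/
def toHilb (B : V →ₗ⋆[ℂ] V →ₗ[ℂ] ℂ) : V →ₗ[ℂ] Hilb B :=
  (UniformSpace.Completion.toComplₗᵢ (𝕜 := ℂ) (E := PreHilb B)).toLinearMap ∘ₗ
    (toPre B).toLinearMap

theorem inner_toHilb {B : V →ₗ⋆[ℂ] V →ₗ[ℂ] ℂ} (h : ∀ v, 0 ≤ B v v) (x y : V) :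
    ⟪toHilb B x, toHilb B y⟫_ℂ = B x y := by
  have : ⟪toHilb B x, toHilb B y⟫_ℂ = psdForm B x y :=
    UniformSpace.Completion.inner_coe (𝕜 := ℂ) (toPre B x) (toPre B y)
  rw [this, psdForm_eq h]

end Form

/-- A bounded ∗-representation on a pre-Hilbert space extends to the completion. -/
def completionRep {S : Type*} [NonUnitalRing S] [Module ℂ S] [Star S] {E : Type*}
    [SeminormedAddCommGroup E] [InnerProductSpace ℂ E] (ρ : S → E →L[ℂ] E)
    (hadd : ∀ s t, ρ (s + t) = ρ s + ρ t) (hsmul : ∀ (c : ℂ) s, ρ (c • s) = c • ρ s)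
    (hmul : ∀ s t, ρ (s * t) = ρ s ∘L ρ t)
    (hstar : ∀ s u v, ⟪ρ (star s) u, v⟫_ℂ = ⟪u, ρ s v⟫_ℂ) :
    S →⋆ₙₐ[ℂ] (UniformSpace.Completion E →L[ℂ] UniformSpace.Completion E) where
  toFun s := (ρ s).completion
  map_smul' c s := by
    ext v
    induction v using UniformSpace.Completion.induction_on with
    | hp => exact isClosed_eq (ContinuousLinearMap.continuous _) (ContinuousLinearMap.continuous _)
    | ih v => simp [hsmul]
  map_zero' := by
    have h0 : ρ 0 = 0 := by simpa using hadd 0 0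
    ext v
    induction v using UniformSpace.Completion.induction_on with
    | hp => exact isClosed_eq (ContinuousLinearMap.continuous _) (ContinuousLinearMap.continuous _)
    | ih v => simpa [h0] using UniformSpace.Completion.coe_zero
  map_add' s t := by
    ext v
    induction v using UniformSpace.Completion.induction_on with
    | hp => exact isClosed_eq (ContinuousLinearMap.continuous _) (ContinuousLinearMap.continuous _)
    | ih v => simp [hadd, UniformSpace.Completion.coe_add]
  map_mul' s t := by
    ext v
    induction v using UniformSpace.Completion.induction_on with
    | hp => exact isClosed_eq (ContinuousLinearMap.continuous _) (ContinuousLinearMap.continuous _)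
    | ih v => simp [hmul]
  map_star' s := by
    refine (ContinuousLinearMap.eq_adjoint_iff _ _).mpr ?_
    intro x y
    induction x, y using UniformSpace.Completion.induction_on₂ with
    | hp => apply isClosed_eq <;> fun_prop
    | ih x y => simpa using hstar s x y

/-- A Hilbert `S`-`S`-bimodule: a Hilbert space with commuting ∗-homomorphisms of `S` and of the
opposite algebra `Sᵐᵒᵖ` into the bounded operators. The vector `s · ξ · t` is
`left s (right (op t) ξ)`. -/
structure Bimod (S : Type u) [NonUnitalRing S] [Module ℂ S] [Star S] where
  /-- The Hilbert space. -/
  carrier : Type u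
  [normed : NormedAddCommGroup carrier]
  [inner : InnerProductSpace ℂ carrier]
  [complete : CompleteSpace carrier]
  /-- The left action. -/
  left : S →⋆ₙₐ[ℂ] (carrier →L[ℂ] carrier)
  /-- The right action. -/
  right : Sᵐᵒᵖ →⋆ₙₐ[ℂ] (carrier →L[ℂ] carrier)
  comm : ∀ s t ξ, left s (right t ξ) = right t (left s ξ)

attribute [instance] Bimod.normed Bimod.inner Bimod.complete

/-! ### The gradient tensor product and Hochschild cocycles

In this section `S` stands for the ∗-algebra `𝒜`, `A` for its closure, `ι : S → A` for the inclusion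
and `Δ : S → S` for the generator. -/

section Gradient

set_option linter.unusedSectionVars false

variable {S A : Type u} [NonUnitalRing S] [StarRing S] [Module ℂ S] [IsScalarTower ℂ S S]
  [SMulCommClass ℂ S S] [StarModule ℂ S] [NonUnitalRing A] [StarRing A] [Module ℂ A]
  (ι : S →⋆ₙₐ[ℂ] A) (Δ : S →ₗ[ℂ] S)

/-- The gradient form `Γ(x, y) = (Δ(y)* x + y* Δ(x) - Δ(y* x)) / 2`. -/
def Γ (x y : S) : S := (1 / 2 : ℂ) • (star (Δ y) * x + star y * Δ x - Δ (star y * x))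

theorem Γ_add_left (x x' y : S) : Γ Δ (x + x') y = Γ Δ x y + Γ Δ x' y := by
  simp only [Γ, ← smul_add, map_add, mul_add]
  congr 1
  abel

theorem Γ_add_right (x y y' : S) : Γ Δ x (y + y') = Γ Δ x y + Γ Δ x y' := by
  simp only [Γ, ← smul_add, map_add, star_add, add_mul]
  congr 1
  abel

theorem Γ_smul_left (c : ℂ) (x y : S) : Γ Δ (c • x) y = c • Γ Δ x y := by
  simp only [Γ, map_smul, mul_smul_comm, ← smul_add, ← smul_sub]
  rw [smul_comm]

theorem Γ_smul_right (c : ℂ) (x y : S) : Γ Δ x (c • y) = (starRingEnd ℂ) c • Γ Δ x y := by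
  simp only [Γ, map_smul, star_smul, smul_mul_assoc, ← smul_add, ← smul_sub, Complex.star_def]
  rw [smul_comm]

variable (H : Bimod A)

/-- The form on `𝒜 ⊗ H` with `⟨x ⊗ ξ, y ⊗ η⟩ = ⟨ξ, Γ(y, x) η⟩`. With inner products that are
linear in the first variable, this is `⟨x ⊗ ξ, y ⊗ η⟩ = ⟨Γ(x, y) ξ, η⟩`. -/
def gradForm : (S ⊗[ℂ] H.carrier) →ₗ⋆[ℂ] (S ⊗[ℂ] H.carrier) →ₗ[ℂ] ℂ :=
  TensorProduct.lift
    (LinearMap.mk₂'ₛₗ (starRingEnd ℂ) (starRingEnd ℂ)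
      (fun x ξ => TensorProduct.lift
        (LinearMap.mk₂ ℂ (fun y η => ⟪ξ, H.left (ι (Γ Δ y x)) η⟫_ℂ)
          (fun y y' η => by rw [Γ_add_left, map_add, map_add, add_apply,
            inner_add_right])
          (fun c y η => by rw [Γ_smul_left, map_smul, map_smul, smul_apply,
            inner_smul_right, smul_eq_mul])
          (fun y η η' => by rw [map_add, inner_add_right])
          (fun c y η => by rw [map_smul, inner_smul_right, smul_eq_mul])))
      (fun x x' ξ => by
        ext y η
        simp [Γ_add_right])
      (fun c x ξ => by
        ext y η
        simp [Γ_smul_right])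
      (fun x ξ ξ' => by
        ext y η
        simp)
      (fun c x ξ => by
        ext y η
        simp [mul_comm]))

theorem gradForm_tmul (x y : S) (ξ η : H.carrier) :
    gradForm ι Δ H (x ⊗ₜ ξ) (y ⊗ₜ η) = ⟪ξ, H.left (ι (Γ Δ y x)) η⟫_ℂ := rfl

/-- The Hilbert space of the gradient tensor product `H_∇`. -/
abbrev GradHilb : Type u := Hilb (gradForm ι Δ H)

/-- The class `a ⊗_∇ ξ` of `a ⊗ ξ` in `H_∇`. -/
def gradTmul : S →ₗ[ℂ] H.carrier →ₗ[ℂ] GradHilb ι Δ H :=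
  (TensorProduct.mk ℂ S H.carrier).compr₂ (toHilb (gradForm ι Δ H))

/-- The pair `(l, r)` consists of commuting left and right actions of `A` on `H_∇` with
`x · (y ⊗_∇ ξ) = xy ⊗_∇ ξ - x ⊗_∇ yξ` and `(y ⊗_∇ ξ) · x = y ⊗_∇ ξx`
for `x, y ∈ 𝒜` and `ξ ∈ H`. -/
def IsGradAction (l : A →⋆ₙₐ[ℂ] (GradHilb ι Δ H →L[ℂ] GradHilb ι Δ H))
    (r : Aᵐᵒᵖ →⋆ₙₐ[ℂ] (GradHilb ι Δ H →L[ℂ] GradHilb ι Δ H)) : Prop :=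
  (∀ s t v, l s (r t v) = r t (l s v)) ∧
  (∀ (x y : S) (ξ : H.carrier), l (ι x) (gradTmul ι Δ H y ξ) =
    gradTmul ι Δ H (x * y) ξ - gradTmul ι Δ H x (H.left (ι y) ξ)) ∧
  (∀ (x y : S) (ξ : H.carrier), r (MulOpposite.op (ι x)) (gradTmul ι Δ H y ξ) =
    gradTmul ι Δ H y (H.right (MulOpposite.op (ι x)) ξ))

open Classical in
/-- The left and right actions on `H_∇`. If `ι` is isometric with dense range, at most one pair
satisfies `IsGradAction`. That there is one in the case considered is part of the main theorem
(without one, the value would be `0`). -/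
def gradAction : (A →⋆ₙₐ[ℂ] (GradHilb ι Δ H →L[ℂ] GradHilb ι Δ H)) ×
    (Aᵐᵒᵖ →⋆ₙₐ[ℂ] (GradHilb ι Δ H →L[ℂ] GradHilb ι Δ H)) :=
  if h : ∃ p : (A →⋆ₙₐ[ℂ] (GradHilb ι Δ H →L[ℂ] GradHilb ι Δ H)) ×
    (Aᵐᵒᵖ →⋆ₙₐ[ℂ] (GradHilb ι Δ H →L[ℂ] GradHilb ι Δ H)), IsGradAction ι Δ H p.1 p.2
  then h.choose else (0, 0)

/-- The gradient tensor product `H_∇`, as a bimodule. -/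
def grad : Bimod A where
  carrier := GradHilb ι Δ H
  left := (gradAction ι Δ H).1
  right := (gradAction ι Δ H).2
  comm s t v := by
    unfold gradAction
    split_ifs with h
    · exact h.choose_spec.1 s t v
    · simp

/-- `H_{∇⁽ⁿ⁾}`, the `n`-fold application of `H ↦ H_∇`. -/
def gradPow : ℕ → Bimod A
  | 0 => H
  | n + 1 => grad ι Δ (gradPow n)

/-- The map `a_1 ⊗ ⋯ ⊗ a_n ↦ a_1 ⊗_∇ (a_2 ⊗_∇ ⋯ (a_n ⊗_∇ ξ))`. Linear maps on the `n`-fold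
tensor power of `S` are represented by `n`-linear maps on `S`. -/
def iterTmul (ξ : H.carrier) :
    (n : ℕ) → MultilinearMap ℂ (fun _ : Fin n => S) (gradPow ι Δ H n).carrier
  | 0 => MultilinearMap.constOfIsEmpty ℂ _ ξ
  | n + 1 => LinearMap.uncurryLeft (M := fun _ : Fin (n + 1) => S)
      { toFun := fun a => (gradTmul ι Δ (gradPow ι Δ H n) a).compMultilinearMap (iterTmul ξ n)
        map_add' := fun a b => by
          ext m
          exact LinearMap.map_add₂ (gradTmul ι Δ (gradPow ι Δ H n)) a b (iterTmul ξ n m)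
        map_smul' := fun c a => by
          ext m
          exact LinearMap.map_smul₂ (gradTmul ι Δ (gradPow ι Δ H n)) c a (iterTmul ξ n m) }

variable (n : ℕ)

/-- The Hochschild differential `d_n f`, as a function of `a_1, …, a_{n+1}` (`a 0, …, a n` here);
in the `k`-th term of the sum the product `a_{k+1} a_{k+2}` is entered in place `k + 1`. -/
def hochschildD (f : MultilinearMap ℂ (fun _ : Fin n => S) H.carrier) (a : Fin (n + 1) → S) :
    H.carrier :=
  H.left (ι (a 0)) (f fun i => a i.succ) +
    ∑ k : Fin n, (-1 : ℂ) ^ ((k : ℕ) + 1) •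
      f (fun i => if i < k then a i.castSucc else
        if i = k then a i.castSucc * a i.succ else a i.succ) +
    (-1 : ℂ) ^ (n + 1) • H.right (MulOpposite.op (ι (a (Fin.last n)))) (f fun i => a i.castSucc)

/-- The space `Cⁿ(𝒜, H)` of Hochschild `n`-cocycles: the kernel of `d_n`. -/
def hochschildCocycles :
    Submodule ℂ (MultilinearMap ℂ (fun _ : Fin n => S) H.carrier) where
  carrier := {f | ∀ a, hochschildD ι H n f a = 0}
  add_mem' {f g} hf hg a := by
    have := congrArg₂ (· + ·) (hf a) (hg a)
    simp only [hochschildD, add_zero] at this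
    rw [← this]
    simp only [hochschildD, add_apply, map_add, smul_add, Finset.sum_add_distrib]
    abel
  zero_mem' a := by simp [hochschildD]
  smul_mem' c f hf a := by
    have := congrArg (c • ·) (hf a)
    simp only [hochschildD, smul_zero, smul_add, Finset.smul_sum] at this
    rw [← this]
    simp only [hochschildD, smul_apply, map_smul, smul_comm c]

end Gradient

/-! ### Finite von Neumann algebras and quantum Markov semi-groups -/

section VN

variable {K : Type u} [NormedAddCommGroup K] [InnerProductSpace ℂ K] [CompleteSpace K]

/-- The `σ`-weak topology on `B(K)`: the coarsest topology for which the functionals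
`x ↦ ∑ ⟨ξ_i, x η_i⟩`, with square summable sequences `ξ`, `η`, are continuous. -/
abbrev sigmaWeak (K : Type u) [NormedAddCommGroup K] [InnerProductSpace ℂ K] :
    TopologicalSpace (K →L[ℂ] K) :=
  ⨅ p : {p : (ℕ → K) × (ℕ → K) //
      (Summable fun i => ‖p.1 i‖ ^ 2) ∧ (Summable fun i => ‖p.2 i‖ ^ 2)},
    TopologicalSpace.induced (fun x : K →L[ℂ] K => ∑' i, ⟪p.1.1 i, x (p.1.2 i)⟫_ℂ) inferInstance

/-- The elements of a von Neumann algebra, with the operator norm. -/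
def Elt (M : VonNeumannAlgebra K) : Type u := M.toStarSubalgebra

theorem isClosed_vn (M : VonNeumannAlgebra K) :
    IsClosed (M.toStarSubalgebra : Set (K →L[ℂ] K)) := by
  rw [VonNeumannAlgebra.coe_toStarSubalgebra, ← M.centralizer_centralizer]
  exact Set.isClosed_centralizer _

instance (M : VonNeumannAlgebra K) : CStarAlgebra (Elt M) :=
  haveI := isClosed_vn M
  inferInstanceAs (CStarAlgebra M.toStarSubalgebra)

/-- The operator on `K` given by an element of `M`. -/
def Elt.op {M : VonNeumannAlgebra K} : Elt M →⋆ₐ[ℂ] (K →L[ℂ] K) := M.toStarSubalgebra.subtype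

/-- A faithful normal finite trace on `M` (not necessarily normalised). -/
structure FiniteTrace (M : VonNeumannAlgebra K) where
  /-- The underlying functional. -/
  τ : Elt M →ₗ[ℂ] ℂ
  pos : ∀ x : Elt M, (Elt.op x).IsPositive → 0 ≤ τ x
  tracial : ∀ x y, τ (x * y) = τ (y * x)
  faithful : ∀ x, τ (star x * x) = 0 → x = 0
  normal : @Continuous _ _ (TopologicalSpace.induced Elt.op (sigmaWeak K)) _ τ

variable {M : VonNeumannAlgebra K}

/-- Complete positivity: for every `n`, the amplification of `Φ` to `n × n` matrices, which act on
`K ⊕ ⋯ ⊕ K`, maps positive operators to positive operators. -/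
def IsCompletelyPositive (Φ : Elt M →ₗ[ℂ] Elt M) : Prop :=
  ∀ (n : ℕ) (T : Matrix (Fin n) (Fin n) (Elt M)),
    (∀ ξ : Fin n → K, 0 ≤ ∑ i, ∑ j, ⟪ξ i, Elt.op (T i j) (ξ j)⟫_ℂ) →
    ∀ ξ : Fin n → K, 0 ≤ ∑ i, ∑ j, ⟪ξ i, Elt.op (Φ (T i j)) (ξ j)⟫_ℂ

/-- A quantum Markov semi-group on `(M, τ)`. -/
structure QMS (τ : FiniteTrace M) where
  /-- The maps `Φ_t`, for `t ≥ 0`. -/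
  Φ : ℝ≥0 → Elt M →ₗ[ℂ] Elt M
  zero : Φ 0 = LinearMap.id
  add : ∀ s t, Φ (s + t) = Φ s ∘ₗ Φ t
  unital : ∀ t, Φ t 1 = 1
  cp : ∀ t, IsCompletelyPositive (Φ t)
  trace : ∀ t x, τ.τ (Φ t x) = τ.τ x
  symm : ∀ t x y, τ.τ (Φ t x * y) = τ.τ (x * Φ t y)
  cont : ∀ (x : Elt M) (ζ : K), Continuous fun t : ℝ≥0 => Elt.op (Φ t x) ζ

namespace FiniteTrace

variable (τ : FiniteTrace M)

/-- The form `(x, y) ↦ τ(x* y)` on `M`. -/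
def form : Elt M →ₗ⋆[ℂ] Elt M →ₗ[ℂ] ℂ :=
  LinearMap.mk₂'ₛₗ (starRingEnd ℂ) (RingHom.id ℂ) (fun x y => τ.τ (star x * y))
    (fun x y z => by simp [add_mul]) (fun c x y => by simp)
    (fun x y z => by simp [mul_add]) (fun c x y => by simp)

@[simp] theorem form_apply (x y : Elt M) : τ.form x y = τ.τ (star x * y) := rfl

theorem form_nonneg (x : Elt M) : 0 ≤ τ.form x x := by
  apply τ.pos
  exact ContinuousLinearMap.isPositive_adjoint_comp_self (Elt.op x)

/-- `L₂(M, τ)`. -/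
abbrev L2 : Type u := Hilb τ.form

/-- The map `x ↦ x Ω_τ` from `M` to `L₂(M, τ)`. -/
def toL2 : Elt M →ₗ[ℂ] τ.L2 := toHilb τ.form

/-- The vector `Ω_τ` given by `1 ∈ M`. -/
def Ω : τ.L2 := τ.toL2 1

theorem inner_toL2 (x y : Elt M) : ⟪τ.toL2 x, τ.toL2 y⟫_ℂ = τ.τ (star x * y) :=
  inner_toHilb τ.form_nonneg x y

theorem toL2_injective : Function.Injective τ.toL2 := by
  rw [injective_iff_map_eq_zero]
  intro x hx
  apply τ.faithful
  rw [← inner_toL2, hx, inner_zero_left]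

theorem bound_aux (a x : Elt M) :
    τ.τ (star (a * x) * (a * x)) ≤ (‖a‖ ^ 2 : ℝ) * τ.τ (star x * x) := by
  have h := τ.pos (((‖a‖ ^ 2 : ℝ) : ℂ) • (star x * x) - star (a * x) * (a * x)) (by
    rw [ContinuousLinearMap.isPositive_iff_complex]
    intro ζ
    have e : Elt.op (((‖a‖ ^ 2 : ℝ) : ℂ) • (star x * x) - star (a * x) * (a * x)) ζ = ((‖a‖ ^ 2 : ℝ) : ℂ) • (ContinuousLinearMap.adjoint (Elt.op x))
          ((Elt.op x) ζ) - (ContinuousLinearMap.adjoint ((Elt.op a) * (Elt.op x)))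
          ((Elt.op a) ((Elt.op x) ζ)) := rfl
    rw [e, inner_sub_left, inner_smul_left, ContinuousLinearMap.adjoint_inner_left,
      ContinuousLinearMap.adjoint_inner_left, mul_apply_eq_comp,
      inner_self_eq_norm_sq_to_K, inner_self_eq_norm_sq_to_K]
    have hb : ‖(Elt.op a) ((Elt.op x) ζ)‖ ^ 2 ≤ ‖a‖ ^ 2 * ‖(Elt.op x) ζ‖ ^ 2 := by
      rw [← mul_pow]
      exact pow_le_pow_left₀ (norm_nonneg _) (ContinuousLinearMap.le_opNorm _ _) 2
    constructor
    · apply Complex.ext <;> simp [← Complex.ofReal_pow]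
    · simpa [← Complex.ofReal_pow] using hb)
  rw [map_sub, map_smul, smul_eq_mul, sub_nonneg] at h
  exact h

theorem norm_sq_pre (x : PreHilb τ.form) :
    ((‖x‖ ^ 2 : ℝ) : ℂ) = τ.τ (star ((toPre τ.form).symm x) * (toPre τ.form).symm x) := by
  have h : ⟪x, x⟫_ℂ = psdForm τ.form ((toPre τ.form).symm x) ((toPre τ.form).symm x) := rfl
  rw [psdForm_eq τ.form_nonneg, form_apply] at h
  rw [← h, inner_self_eq_norm_sq_to_K]
  simp

/-- Left multiplication. -/
def leftPre (a : Elt M) : PreHilb τ.form →L[ℂ] PreHilb τ.form :=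
  ((toPre τ.form).toLinearMap ∘ₗ LinearMap.mulLeft ℂ a ∘ₗ
    (toPre τ.form).symm.toLinearMap).mkContinuous ‖a‖ (by
      intro x
      rw [← sq_le_sq₀ (norm_nonneg _) (by positivity), mul_pow]
      have h := τ.bound_aux a ((toPre τ.form).symm x)
      rw [← norm_sq_pre] at h
      rw [← Complex.real_le_real, norm_sq_pre]
      simpa using h)

/-- Right multiplication. -/
def rightPre (a : Elt M) : PreHilb τ.form →L[ℂ] PreHilb τ.form :=
  ((toPre τ.form).toLinearMap ∘ₗ LinearMap.mulRight ℂ a ∘ₗ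
    (toPre τ.form).symm.toLinearMap).mkContinuous ‖a‖ (by
      intro x
      rw [← sq_le_sq₀ (norm_nonneg _) (by positivity), mul_pow]
      have h := τ.bound_aux (star a) (star ((toPre τ.form).symm x))
      have e1 : τ.τ (star (star a * star ((toPre τ.form).symm x)) *
          (star a * star ((toPre τ.form).symm x))) =
          τ.τ (star ((toPre τ.form).symm x * a) * ((toPre τ.form).symm x * a)) := by
        rw [τ.tracial]
        simp
      have e2 : τ.τ (star (star ((toPre τ.form).symm x)) * star ((toPre τ.form).symm x)) =
          τ.τ (star ((toPre τ.form).symm x) * (toPre τ.form).symm x) := by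
        rw [τ.tracial]
        simp
      rw [e1, e2, ← norm_sq_pre, norm_star] at h
      rw [← Complex.real_le_real, norm_sq_pre]
      simpa using h)

end FiniteTrace

/-- The data of the ∗-algebra `𝒜`: a `σ`-weakly dense ∗-subalgebra of `M` (not necessarily unital)
such that `𝒜 Ω_τ` lies in the domain of the generator `Δ` of the semi-group
`x Ω_τ ↦ Φ_t(x) Ω_τ` on `L₂(M, τ)`, such that `Δ(𝒜 Ω_τ) ⊆ 𝒜 Ω_τ`, and such that `t ↦ Φ_t(a)` is
norm continuous for `a ∈ 𝒜`. Here `Δ ξ = lim_{t ↓ 0} (ξ - Φ_t ξ) / t`, the domain being the set of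
`ξ` for which this limit exists, so that `Φ_t = exp(-t Δ)`. -/
structure CoreAlgebra {τ : FiniteTrace M} (P : QMS τ) where
  /-- The algebra `𝒜`. -/
  alg : NonUnitalStarSubalgebra ℂ (Elt M)
  dense : ∀ x : Elt M, Elt.op x ∈
    @closure _ (sigmaWeak K) (Elt.op '' (alg : Set (Elt M)))
  generator : ∀ a : alg, ∃ b : alg,
    Filter.Tendsto (fun t : ℝ≥0 => ((t : ℂ)⁻¹) • (τ.toL2 (a : Elt M) - τ.toL2 (P.Φ t a)))
      (𝓝[>] 0) (𝓝 (τ.toL2 (b : Elt M)))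
  norm_cont : ∀ a : alg, Continuous fun t : ℝ≥0 => P.Φ t (a : Elt M)

namespace CoreAlgebra

variable {τ : FiniteTrace M} {P : QMS τ} (C : CoreAlgebra P)

theorem delta_unique {a b b' : Elt M}
    (h : Filter.Tendsto (fun t : ℝ≥0 => ((t : ℂ)⁻¹) • (τ.toL2 a - τ.toL2 (P.Φ t a)))
      (𝓝[>] 0) (𝓝 (τ.toL2 b)))
    (h' : Filter.Tendsto (fun t : ℝ≥0 => ((t : ℂ)⁻¹) • (τ.toL2 a - τ.toL2 (P.Φ t a)))
      (𝓝[>] 0) (𝓝 (τ.toL2 b'))) : b = b' :=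
  τ.toL2_injective (tendsto_nhds_unique h h')

/-- The generator on the level of `𝒜`: `Δ(a) Ω_τ = Δ(a Ω_τ)`. -/
def delta : C.alg →ₗ[ℂ] C.alg where
  toFun a := (C.generator a).choose
  map_add' a b := by
    have h := ((C.generator a).choose_spec.add (C.generator b).choose_spec)
    rw [← map_add] at h
    refine Subtype.ext (delta_unique (P := P) (C.generator (a + b)).choose_spec (h.congr ?_))
    intro t
    rw [show ((a + b : C.alg) : Elt M) = (a : Elt M) + (b : Elt M) from rfl, ← smul_add, map_add,
      map_add, map_add]
    congr 1
    abel
  map_smul' c a := by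
    have h := (C.generator a).choose_spec.const_smul c
    rw [← map_smul] at h
    refine Subtype.ext (delta_unique (P := P) (C.generator (c • a)).choose_spec (h.congr ?_))
    intro t
    rw [show ((c • a : C.alg) : Elt M) = c • (a : Elt M) from rfl, map_smul, map_smul, map_smul,
      ← smul_sub, smul_comm]

theorem delta_spec (a : C.alg) :
    Filter.Tendsto (fun t : ℝ≥0 => ((t : ℂ)⁻¹) • (τ.toL2 (a : Elt M) - τ.toL2 (P.Φ t a)))
      (𝓝[>] 0) (𝓝 (τ.toL2 (C.delta a : Elt M))) :=
  (C.generator a).choose_spec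

/-- The C*-algebra `A`, the norm closure of `𝒜`. -/
abbrev A : Type u := C.alg.topologicalClosure

/-- The inclusion of `𝒜` in `A`. -/
def incl : C.alg →⋆ₙₐ[ℂ] C.A where
  toFun a := ⟨a, C.alg.le_topologicalClosure a.2⟩
  map_smul' _ _ := rfl
  map_zero' := rfl
  map_add' _ _ := rfl
  map_mul' _ _ := rfl
  map_star' _ := rfl

theorem pre_adj_left (a : Elt M) (u v : PreHilb τ.form) :
    ⟪τ.leftPre (star a) u, v⟫_ℂ = ⟪u, τ.leftPre a v⟫_ℂ := by
  have h (u v : PreHilb τ.form) : ⟪u, v⟫_ℂ =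
      τ.τ (star ((toPre τ.form).symm u) * (toPre τ.form).symm v) := by
    have h : ⟪u, v⟫_ℂ = psdForm τ.form ((toPre τ.form).symm u) ((toPre τ.form).symm v) := rfl
    rw [h, psdForm_eq τ.form_nonneg, FiniteTrace.form_apply]
  rw [h, h]
  simp [FiniteTrace.leftPre, mul_assoc]

theorem pre_adj_right (a : Elt M) (u v : PreHilb τ.form) :
    ⟪τ.rightPre (star a) u, v⟫_ℂ = ⟪u, τ.rightPre a v⟫_ℂ := by
  have h (u v : PreHilb τ.form) : ⟪u, v⟫_ℂ =
      τ.τ (star ((toPre τ.form).symm u) * (toPre τ.form).symm v) := by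
    have h : ⟪u, v⟫_ℂ = psdForm τ.form ((toPre τ.form).symm u) ((toPre τ.form).symm v) := rfl
    rw [h, psdForm_eq τ.form_nonneg, FiniteTrace.form_apply]
  rw [h, h]
  simp only [FiniteTrace.rightPre, LinearMap.mkContinuous_apply, LinearMap.comp_apply,
    LinearEquiv.coe_coe, LinearEquiv.symm_apply_apply, LinearMap.mulRight_apply, star_mul,
    star_star]
  rw [mul_assoc, τ.tracial, mul_assoc]

/-- The trivial bimodule `L₂(M)`, restricted to `A`: `a · xΩ_τ · b = axbΩ_τ`. -/
def L2Bimod : Bimod C.A where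
  carrier := τ.L2
  left := completionRep (fun a : C.A => τ.leftPre (a : Elt M))
    (by intro s t; ext v; simp [FiniteTrace.leftPre, add_mul])
    (by intro c s; ext v; simp [FiniteTrace.leftPre])
    (by intro s t; ext v; simp [FiniteTrace.leftPre, mul_assoc])
    (fun s u v => pre_adj_left _ u v)
  right := completionRep (fun a : C.Aᵐᵒᵖ => τ.rightPre (a.unop : Elt M))
    (by intro s t; ext v; simp [FiniteTrace.rightPre, mul_add])
    (by intro c s; ext v; simp [FiniteTrace.rightPre])
    (by intro s t; ext v; simp [FiniteTrace.rightPre, mul_assoc])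
    (fun s u v => pre_adj_right _ u v)
  comm s t ξ := by
    change (τ.leftPre _).completion ((τ.rightPre _).completion ξ) =
      (τ.rightPre _).completion ((τ.leftPre _).completion ξ)
    induction ξ using UniformSpace.Completion.induction_on with
    | hp => apply isClosed_eq <;> fun_prop
    | ih v => simp [FiniteTrace.leftPre, FiniteTrace.rightPre, mul_assoc]

theorem L2Bimod_left (a : C.A) (x : Elt M) :
    C.L2Bimod.left a (τ.toL2 x) = τ.toL2 ((a : Elt M) * x) :=
  ContinuousLinearMap.completion_apply_coe (τ.leftPre (a : Elt M)) (toPre τ.form x)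

theorem L2Bimod_right (a : C.A) (x : Elt M) :
    C.L2Bimod.right (MulOpposite.op a) (τ.toL2 x) = τ.toL2 (x * (a : Elt M)) :=
  ContinuousLinearMap.completion_apply_coe (τ.rightPre (a : Elt M)) (toPre τ.form x)

/-- `L₂(M)_{∇⁽ⁿ⁾}`. -/
def L2Grad (n : ℕ) : Bimod C.A := gradPow C.incl C.delta C.L2Bimod n

/-- The class `a ⊗_∇ ξ` in `L₂(M)_{∇⁽ⁿ⁺¹⁾}` of `a ∈ 𝒜` and `ξ ∈ L₂(M)_{∇⁽ⁿ⁾}`. -/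
def tmul (n : ℕ) : C.alg →ₗ[ℂ] (C.L2Grad n).carrier →ₗ[ℂ] (C.L2Grad (n + 1)).carrier :=
  gradTmul C.incl C.delta (C.L2Grad n)

/-- The map `∂_n(a_1 ⊗ ⋯ ⊗ a_n) = a_1 ⊗_∇ ⋯ ⊗_∇ a_n ⊗_∇ Ω_τ`. -/
def partialMap (n : ℕ) : MultilinearMap ℂ (fun _ : Fin n => C.alg) (C.L2Grad n).carrier :=
  iterTmul C.incl C.delta C.L2Bimod τ.Ω n

end CoreAlgebra

end VN

end GradientCocycle

end

namespace GradientCocycle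

universe u

/-! Everything except the cocycle algebra rests on complete positivity of `Φ_t`. In the Stinespring
dilation of `Φ_t`, the Gram matrix of the vectors `y ⊗ ξ - 1 ⊗ yξ` is given by `Φ_t(y*z) - Φ_t(y*)z
- y*Φ_t(z) + y*z`. Divided by `2t` it tends to `Γ(z, y)`, so `Γ` is completely positive. Left
multiplication by `x` on the dilation sends `y ⊗ ξ - 1 ⊗ yξ` to the difference of the vectors of
this form for `(xy, ξ)` and `(x, yξ)`, which is the formula for the action on `H_∇`. Inserting the
positive weight `‖x‖² - x*x` into the dilation form therefore shows that this action is bounded by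
`‖x‖` (`dilationForm_nonneg`, `weightedΓ_nonneg`).

The limits are needed in norm, whereas the generator is defined in `L₂`. Norm continuity on `𝒜` lets
one integrate `Φ_s(Δ a)` in `M`; since `M` embeds in `L₂`, the formula `a - Φ_t(a) = ∫₀ᵗ Φ_s(Δ a)
ds` holds in `M`, and `Δ` is a norm derivative on `𝒜` (`tendsto_delta`).

The estimates are obtained on `K` but wanted on every bimodule `H`. Positivity of a matrix over a
C⋆-algebra can be tested in one faithful representation (`matrix_nonneg_of_injective`). The left
action then extends from `𝒜` to `A` by density, and the right action is contractive because it is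
given by adjointable operators.

The cocycle identity is an induction: the Hochschild differential of `∂_{n+1}` at `(a_0, …)` is
`-a_0 ⊗_∇` the differential of `∂_n`, down to `aΩ - Ωa = 0`. The inner product formula for `∂_1`
uses `τ ∘ Δ = 0` and the symmetry of `Δ`; it implies closability. -/

theorem isPositive_of_inner_nonneg {E : Type*} [NormedAddCommGroup E] [InnerProductSpace ℂ E]
    {T : E →L[ℂ] E} (h : ∀ v, 0 ≤ ⟪v, T v⟫_ℂ) : T.IsPositive := by
  rw [ContinuousLinearMap.isPositive_iff_complex]
  intro v
  have e : ⟪T v, v⟫_ℂ = ⟪v, T v⟫_ℂ := by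
    rw [← inner_conj_symm, Complex.conj_eq_iff_im]
    exact (Complex.le_def.1 (h v)).2.symm
  obtain ⟨h1, h2⟩ := Complex.le_def.1 (h v)
  rw [e]
  exact ⟨Complex.ext rfl h2, h1⟩

/-! ### Positivity of matrices over a C⋆-algebra and its independence of the representation. -/

section MatrixRep

variable {n A H : Type*} [Fintype n] [NonUnitalCStarAlgebra A]
  [NormedAddCommGroup H] [InnerProductSpace ℂ H]

/-- The bounded operator on `H ⊕ ⋯ ⊕ H` given by a matrix of bounded operators. -/
noncomputable def matrixOp (T : n → n → H →L[ℂ] H) :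
    PiLp 2 (fun _ : n => H) →L[ℂ] PiLp 2 (fun _ : n => H) :=
  (PiLp.continuousLinearEquiv 2 ℂ (fun _ : n => H)).symm.toContinuousLinearMap ∘L
    ContinuousLinearMap.pi fun i => ∑ j, T i j ∘L PiLp.proj 2 (fun _ : n => H) j

theorem matrixOp_apply (T : n → n → H →L[ℂ] H) (ξ : PiLp 2 (fun _ : n => H)) (i : n) :
    matrixOp T ξ i = ∑ j, T i j (ξ j) := by
  simp [matrixOp]

theorem inner_matrixOp (T : n → n → H →L[ℂ] H) (ξ η : PiLp 2 (fun _ : n => H)) :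
    ⟪η, matrixOp T ξ⟫_ℂ = ∑ i, ∑ j, ⟪η i, T i j (ξ j)⟫_ℂ := by
  simp [PiLp.inner_apply, matrixOp_apply, inner_sum]

variable [CompleteSpace H]

/-- The amplification of a ∗-representation on `H` to matrices, acting on `H ⊕ ⋯ ⊕ H`. -/
noncomputable def matrixRep (π : A →⋆ₙₐ[ℂ] (H →L[ℂ] H)) :
    CStarMatrix n n A →⋆ₙₐ[ℂ] (PiLp 2 (fun _ : n => H) →L[ℂ] PiLp 2 (fun _ : n => H)) where
  toFun T := matrixOp fun i j => π (T i j)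
  map_smul' c T := by
    ext ξ i
    simp [matrixOp_apply, Finset.smul_sum]
  map_zero' := by
    ext ξ i
    simp [matrixOp_apply]
  map_add' S T := by
    ext ξ i
    simp [matrixOp_apply, Finset.sum_add_distrib]
  map_mul' S T := by
    ext ξ i
    simp only [matrixOp_apply, CStarMatrix.mul_apply, map_sum, map_mul, sum_apply,
      mul_apply_eq_comp]
    exact Finset.sum_comm
  map_star' T := by
    refine (ContinuousLinearMap.eq_adjoint_iff _ _).mpr fun ξ η => ?_
    rw [inner_matrixOp, ← inner_conj_symm, inner_matrixOp, map_sum, Finset.sum_comm]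
    refine Finset.sum_congr rfl fun i _ => ?_
    rw [map_sum]
    refine Finset.sum_congr rfl fun j _ => ?_
    rw [CStarMatrix.star_apply, map_star, ContinuousLinearMap.star_eq_adjoint, inner_conj_symm,
      ContinuousLinearMap.adjoint_inner_left]

theorem matrixRep_injective {π : A →⋆ₙₐ[ℂ] (H →L[ℂ] H)} (hπ : Function.Injective π) :
    Function.Injective (matrixRep (n := n) π) := by
  classical
  intro S T h
  ext i j
  apply hπ
  ext v
  have := congrArg (fun R => R (WithLp.toLp 2 (Pi.single j v)) i) h
  simpa [matrixRep, matrixOp_apply, Pi.single_apply, apply_ite] using this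

end MatrixRep

/-- An injective ∗-homomorphism of C⋆-algebras reflects positivity. -/
theorem nonneg_of_map_nonneg {A B : Type*} [NonUnitalCStarAlgebra A] [PartialOrder A]
    [StarOrderedRing A] [NonUnitalCStarAlgebra B] [PartialOrder B] [StarOrderedRing B]
    (φ : A →⋆ₙₐ[ℂ] B) (hφ : Function.Injective φ) {a : A} (h : 0 ≤ φ a) : 0 ≤ a := by
  have hsa : IsSelfAdjoint a := by
    apply hφ
    rw [map_star]
    exact (IsSelfAdjoint.of_nonneg h).star_eq
  have hc : Continuous φ := by
    exact map_continuous φ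
  -- The negative part commutes with `φ` by functional calculus, and that of the positive element `φ
  -- a` vanishes.
  have hneg : φ (a⁻) = 0 := by
    have := NonUnitalStarAlgHomClass.map_cfcₙ (S := ℂ) φ (fun x : ℝ => x⁻) a
      (by fun_prop) (by simp) hc hsa (IsSelfAdjoint.of_nonneg h)
    rw [CFC.negPart_def, this, ← CFC.negPart_def]
    exact (CFC.negPart_eq_zero_iff _ (IsSelfAdjoint.of_nonneg h)).2 h
  rw [← CFC.negPart_eq_zero_iff a hsa]
  exact hφ (by rw [hneg, map_zero])

/-- A matrix over a C⋆-algebra that is positive in a faithful representation is positive in every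
representation. -/
theorem matrix_nonneg_of_injective {n A K H : Type*} [Fintype n] [NonUnitalCStarAlgebra A]
    [NormedAddCommGroup K] [InnerProductSpace ℂ K] [CompleteSpace K]
    [NormedAddCommGroup H] [InnerProductSpace ℂ H] [CompleteSpace H]
    {ρ : A →⋆ₙₐ[ℂ] (K →L[ℂ] K)} (hρ : Function.Injective ρ) (π : A →⋆ₙₐ[ℂ] (H →L[ℂ] H))
    (T : n → n → A) (hT : ∀ ξ : n → K, 0 ≤ ∑ i, ∑ j, ⟪ξ i, ρ (T i j) (ξ j)⟫_ℂ) (ξ : n → H) :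
    0 ≤ ∑ i, ∑ j, ⟪ξ i, π (T i j) (ξ j)⟫_ℂ := by
  let := CStarAlgebra.spectralOrder A
  have := CStarAlgebra.spectralOrderedRing A
  have h1 : 0 ≤ matrixRep ρ (CStarMatrix.ofMatrix T) := by
    rw [ContinuousLinearMap.nonneg_iff_isPositive]
    refine isPositive_of_inner_nonneg fun v => ?_
    have := hT v
    rwa [← inner_matrixOp (fun i j => ρ (T i j)) v v] at this
  have h2 : 0 ≤ CStarMatrix.ofMatrix T :=
    nonneg_of_map_nonneg _ (matrixRep_injective hρ) h1
  have h3 : 0 ≤ matrixRep π (CStarMatrix.ofMatrix T) := map_nonneg _ h2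
  rw [ContinuousLinearMap.nonneg_iff_isPositive] at h3
  have := h3.inner_nonneg_right (WithLp.toLp 2 ξ)
  exact (inner_matrixOp (fun i j => π (T i j)) _ _).symm ▸ this
 
/-- A representation of a C⋆-algebra by adjointable operators on a pre-Hilbert space is
contractive. -/
theorem norm_le_of_adjointable {B V : Type*} [NonUnitalCStarAlgebra B] [SeminormedAddCommGroup V]
    [InnerProductSpace ℂ V] (R : B →ₙₐ[ℂ] Module.End ℂ V)
    (hR : ∀ b u v, ⟪R (star b) u, v⟫_ℂ = ⟪u, R b v⟫_ℂ) (b : B) (v : V) :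
    ‖R b v‖ ≤ ‖b‖ * ‖v‖ := by
  -- The unitization makes room for `‖b‖² - b*b`, which is of the form `c*c`. The inequality is then
  -- `‖c v‖² ≥ 0`, so no boundedness of `R` is needed beforehand.
  let φ : Unitization ℂ B →ₐ[ℂ] Module.End ℂ V := Unitization.lift R
  have hφ (c : Unitization ℂ B) (u v : V) : ⟪φ (star c) u, v⟫_ℂ = ⟪u, φ c v⟫_ℂ := by
    induction c using Unitization.ind with
    | inl_add_inr r a =>
      simp [φ, inner_add_left, inner_add_right, hR,
        Algebra.algebraMap_eq_smul_one, inner_smul_left, inner_smul_right]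
  let := CStarAlgebra.spectralOrder (Unitization ℂ B)
  have := CStarAlgebra.spectralOrderedRing (Unitization ℂ B)
  have hle := CStarAlgebra.star_mul_le_algebraMap_norm_sq (a := (b : Unitization ℂ B))
  rw [← sub_nonneg, CStarAlgebra.nonneg_iff_eq_star_mul_self] at hle
  obtain ⟨c, hc⟩ := hle
  have h1 : (‖R b v‖ ^ 2 : ℂ) =
      ⟪v, φ (star (b : Unitization ℂ B) * (b : Unitization ℂ B)) v⟫_ℂ := by
    rw [map_mul, Module.End.mul_apply, ← hφ, star_star]
    simp [φ, inner_self_eq_norm_sq_to_K]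
  have h2 : (‖φ c v‖ ^ 2 : ℂ) = ⟪v, φ (star c * c) v⟫_ℂ := by
    rw [map_mul, Module.End.mul_apply, ← hφ, star_star]
    simp [inner_self_eq_norm_sq_to_K]
  rw [← hc, map_sub, LinearMap.sub_apply, inner_sub_right, ← h1,
    IsScalarTower.algebraMap_apply ℝ ℂ (Unitization ℂ B), AlgHom.commutes,
    Module.algebraMap_end_apply,
    inner_smul_right, inner_self_eq_norm_sq_to_K, Unitization.norm_inr] at h2
  have h3 : ‖φ c v‖ ^ 2 = ‖b‖ ^ 2 * ‖v‖ ^ 2 - ‖R b v‖ ^ 2 := by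
    apply Complex.ofReal_injective
    simpa using h2
  rw [← sq_le_sq₀ (norm_nonneg _) (by positivity), mul_pow]
  nlinarith [sq_nonneg ‖φ c v‖]

/-- A ∗-homomorphism that is bounded by the norm of a completion extends to it. -/
theorem exists_extension_of_dense {S A B : Type*} [NonUnitalRing S] [StarRing S] [Module ℂ S]
    [NonUnitalCStarAlgebra A] [NonUnitalCStarAlgebra B] (ι : S →⋆ₙₐ[ℂ] A) (hι : DenseRange ι)
    (φ : S →⋆ₙₐ[ℂ] B) (hφ : ∀ s, ‖φ s‖ ≤ ‖ι s‖) : ∃ ψ : A →⋆ₙₐ[ℂ] B, ∀ s, ψ (ι s) = φ s := by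
  let f : S →ₗ[ℂ] B := (φ : S →ₗ[ℂ] B)
  let e : S →ₗ[ℂ] A := (ι : S →ₗ[ℂ] A)
  let g := f.extendOfNorm e
  have hg (s : S) : g (ι s) = φ s :=
    LinearMap.extendOfNorm_eq (f := f) (e := e) hι ⟨1, fun x => (hφ x).trans_eq (one_mul _).symm⟩ s
  refine ⟨{ toFun := g, map_smul' := map_smul g, map_zero' := map_zero g, map_add' := map_add g,
            map_mul' := ?_, map_star' := ?_ }, hg⟩
  · intro x y
    refine hι.induction_on₂ (p := fun x y => g (x * y) = g x * g y) ?_ ?_ x y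
    · exact isClosed_eq (by fun_prop) (by fun_prop)
    · intro s t
      rw [← map_mul, hg, hg, hg, map_mul]
  · intro x
    refine hι.induction_on (p := fun x => g (star x) = star (g x)) x ?_ ?_
    · exact isClosed_eq (by fun_prop) (by fun_prop)
    · intro s
      rw [← map_star, hg, hg, map_star]

theorem continuous_of_starAlgHom {A B : Type*} [NonUnitalCStarAlgebra A] [NonUnitalCStarAlgebra B]
    (φ : A →⋆ₙₐ[ℂ] B) : Continuous φ :=
  AddMonoidHomClass.continuous_of_bound φ 1 fun a => by
    simpa using NonUnitalStarAlgHom.norm_apply_le φ a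

theorem apply_comm_of_dense {S A E V : Type*} [NonUnitalCStarAlgebra A] [NormedAddCommGroup E]
    [InnerProductSpace ℂ E] [CompleteSpace E] {ι : S → A} (hι : DenseRange ι)
    (l : A →⋆ₙₐ[ℂ] (E →L[ℂ] E)) (T : E →L[ℂ] E) {j : V → E} (hj : DenseRange j)
    (h : ∀ s w, l (ι s) (T (j w)) = T (l (ι s) (j w))) (a : A) (v : E) :
    l a (T v) = T (l a v) := by
  have hl : Continuous l := continuous_of_starAlgHom l
  refine hj.induction_on (p := fun v => l a (T v) = T (l a v)) v
    (isClosed_eq (by fun_prop) (by fun_prop)) fun w => ?_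
  exact hι.induction_on (p := fun a => l a (T (j w)) = T (l a (j w))) a
    (isClosed_eq (by fun_prop) (by fun_prop)) fun s => h s w

theorem inner_pre {V : Type u} [AddCommGroup V] [Module ℂ V] {B : V →ₗ⋆[ℂ] V →ₗ[ℂ] ℂ}
    (hB : ∀ v, 0 ≤ B v v) (u v : PreHilb B) :
    ⟪u, v⟫_ℂ = B ((toPre B).symm u) ((toPre B).symm v) := by
  have h : ⟪u, v⟫_ℂ = psdForm B ((toPre B).symm u) ((toPre B).symm v) := rfl
  rw [h, psdForm_eq hB]

theorem denseRange_toHilb {V : Type u} [AddCommGroup V] [Module ℂ V]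
    (B : V →ₗ⋆[ℂ] V →ₗ[ℂ] ℂ) : DenseRange (toHilb B) :=
  (UniformSpace.Completion.denseRange_coe (α := PreHilb B)).comp
    (toPre B).surjective.denseRange (UniformSpace.Completion.continuous_coe _)

/-! ### Left and right actions on `S ⊗ H` and on `H_∇`. -/

section Action

set_option linter.unusedSectionVars false

variable {S A : Type u} [NonUnitalRing S] [StarRing S] [Module ℂ S] [IsScalarTower ℂ S S]
  [SMulCommClass ℂ S S] [StarModule ℂ S] [NonUnitalCStarAlgebra A]
  (ι : S →⋆ₙₐ[ℂ] A) (Δ : S →ₗ[ℂ] S) (H : Bimod A)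

/-- The left action of `x` on `S ⊗ H`: `x · (y ⊗ ξ) = xy ⊗ ξ - x ⊗ yξ`. -/
noncomputable def leftOp (x : S) : (S ⊗[ℂ] H.carrier) →ₗ[ℂ] (S ⊗[ℂ] H.carrier) :=
  LinearMap.rTensor H.carrier (LinearMap.mulLeft ℂ x) -
    TensorProduct.lift (LinearMap.mk₂ ℂ (fun y ξ => x ⊗ₜ[ℂ] H.left (ι y) ξ)
      (fun y y' ξ => by simp [TensorProduct.tmul_add]) (fun c y ξ => by simp)
      (fun y ξ ξ' => by simp [TensorProduct.tmul_add]) (fun c y ξ => by simp))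

theorem leftOp_tmul (x y : S) (ξ : H.carrier) :
    leftOp ι H x (y ⊗ₜ ξ) = (x * y) ⊗ₜ ξ - x ⊗ₜ H.left (ι y) ξ := by
  simp [leftOp]

theorem leftOp_add (x x' : S) : leftOp ι H (x + x') = leftOp ι H x + leftOp ι H x' := by
  ext y ξ
  simp only [leftOp_tmul, LinearMap.add_apply, TensorProduct.AlgebraTensorModule.curry_apply,
    LinearMap.restrictScalars_self, TensorProduct.curry_apply, add_mul, TensorProduct.add_tmul]
  abel

theorem leftOp_smul (c : ℂ) (x : S) : leftOp ι H (c • x) = c • leftOp ι H x := by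
  ext y ξ
  simp [leftOp_tmul, smul_sub, TensorProduct.smul_tmul', smul_mul_assoc]

theorem leftOp_mul (x x' : S) : leftOp ι H (x * x') = leftOp ι H x ∘ₗ leftOp ι H x' := by
  ext y ξ
  simp [leftOp_tmul, mul_assoc]

/-- The right action of `t` on `S ⊗ H`. -/
noncomputable def rightOp (t : Aᵐᵒᵖ) : (S ⊗[ℂ] H.carrier) →ₗ[ℂ] (S ⊗[ℂ] H.carrier) :=
  LinearMap.lTensor S (H.right t : H.carrier →ₗ[ℂ] H.carrier)

theorem rightOp_tmul (t : Aᵐᵒᵖ) (y : S) (ξ : H.carrier) :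
    rightOp H t (y ⊗ₜ ξ) = y ⊗ₜ H.right t ξ := by
  simp [rightOp]

theorem rightOp_add (s t : Aᵐᵒᵖ) :
    rightOp (S := S) H (s + t) = rightOp H s + rightOp H t := by
  ext y ξ
  simp [rightOp_tmul, TensorProduct.tmul_add]

theorem rightOp_smul (c : ℂ) (t : Aᵐᵒᵖ) : rightOp (S := S) H (c • t) = c • rightOp H t := by
  ext y ξ
  simp [rightOp_tmul]

theorem rightOp_mul (s t : Aᵐᵒᵖ) :
    rightOp (S := S) H (s * t) = rightOp H s ∘ₗ rightOp H t := by
  ext y ξ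
  simp [rightOp_tmul]

/-- Both sides are half of `Δ(z*x)y - z*Δ(x)y + z*Δ(xy) - Δ(z*xy)`. This identity is what makes the
left action compatible with adjoints. -/
theorem Γ_star_mul (hΔ : ∀ x, Δ (star x) = star (Δ x)) (x y z : S) :
    Γ Δ y (star x * z) - star z * Γ Δ y (star x) = Γ Δ (x * y) z - Γ Δ x z * y := by
  simp only [Γ, star_mul, star_star, mul_smul_comm, smul_mul_assoc, ← smul_sub, ← hΔ, add_mul,
    sub_mul, mul_add, mul_sub, mul_assoc]
  congr 1
  abel

theorem gradForm_leftOp_left (hΔ : ∀ x, Δ (star x) = star (Δ x)) (x : S)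
    (u v : S ⊗[ℂ] H.carrier) :
    gradForm ι Δ H (leftOp ι H (star x) u) v = gradForm ι Δ H u (leftOp ι H x v) := by
  induction u with
  | zero => simp
  | add u u' hu hu' => simp only [map_add, LinearMap.add_apply, hu, hu']
  | tmul z η =>
    induction v with
    | zero => simp
    | add v v' hv hv' => simp only [map_add, hv, hv']
    | tmul y ξ =>
      have hz (a b : H.carrier) : ⟪H.left (ι z) a, b⟫_ℂ = ⟪a, H.left (ι (star z)) b⟫_ℂ := by
        rw [map_star, map_star, ContinuousLinearMap.star_eq_adjoint,
          ContinuousLinearMap.adjoint_inner_right]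
      rw [leftOp_tmul, leftOp_tmul, map_sub, map_sub, LinearMap.sub_apply, gradForm_tmul,
        gradForm_tmul, gradForm_tmul, gradForm_tmul, hz, ← inner_sub_right, ← inner_sub_right,
        ← mul_apply_eq_comp, ← mul_apply_eq_comp, ← map_mul, ← map_mul, ← map_mul, ← map_mul,
        ← sub_apply, ← sub_apply, ← map_sub, ← map_sub, ← map_sub, ← map_sub, Γ_star_mul Δ hΔ]

theorem gradForm_rightOp_left (t : Aᵐᵒᵖ) (u v : S ⊗[ℂ] H.carrier) :
    gradForm ι Δ H (rightOp H (star t) u) v = gradForm ι Δ H u (rightOp H t v) := by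
  induction u with
  | zero => simp
  | add u u' hu hu' => simp only [map_add, LinearMap.add_apply, hu, hu']
  | tmul z η =>
    induction v with
    | zero => simp
    | add v v' hv hv' => simp only [map_add, hv, hv']
    | tmul y ξ =>
      rw [rightOp_tmul, rightOp_tmul, gradForm_tmul, gradForm_tmul, H.comm, map_star,
        ContinuousLinearMap.star_eq_adjoint, ContinuousLinearMap.adjoint_inner_left]

theorem leftOp_rightOp (x : S) (t : Aᵐᵒᵖ) (v : S ⊗[ℂ] H.carrier) :
    leftOp ι H x (rightOp H t v) = rightOp H t (leftOp ι H x v) := by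
  induction v with
  | zero => simp
  | add v v' hv hv' => simp only [map_add, hv, hv']
  | tmul y ξ => simp only [rightOp_tmul, leftOp_tmul, map_sub, H.comm]

/-- Positivity of the matrices `Γ(y_j, y_i)` and of
`‖x‖² Γ(y_j, y_i) - (Γ(x* x y_j, y_i) - Γ(x* x, y_i) y_j)` in the representation on `H`. -/
structure IsPositiveGradient : Prop where
  star_map : ∀ x, Δ (star x) = star (Δ x)
  nonneg : ∀ (n : ℕ) (y : Fin n → S) (ξ : Fin n → H.carrier),
    0 ≤ ∑ i, ∑ j, ⟪ξ i, H.left (ι (Γ Δ (y j) (y i))) (ξ j)⟫_ℂ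
  bound : ∀ (x : S) (n : ℕ) (y : Fin n → S) (ξ : Fin n → H.carrier),
    0 ≤ ∑ i, ∑ j, ⟪ξ i, H.left (ι (((‖ι x‖ ^ 2 : ℝ) : ℂ) • Γ Δ (y j) (y i) -
      (Γ Δ (star x * x * y j) (y i) - Γ Δ (star x * x) (y i) * y j))) (ξ j)⟫_ℂ

variable {ι Δ H}

theorem IsPositiveGradient.gradForm_nonneg (h : IsPositiveGradient ι Δ H)
    (v : S ⊗[ℂ] H.carrier) : 0 ≤ gradForm ι Δ H v v := by
  obtain ⟨n, y, ξ, rfl⟩ := TensorProduct.exists_sum_tmul_eq v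
  simp only [map_sum, LinearMap.sum_apply, gradForm_tmul]
  rw [Finset.sum_comm]
  exact h.nonneg n y ξ

theorem IsPositiveGradient.gradForm_leftOp_le (h : IsPositiveGradient ι Δ H) (x : S)
    (v : S ⊗[ℂ] H.carrier) : gradForm ι Δ H (leftOp ι H x v) (leftOp ι H x v) ≤
      ((‖ι x‖ ^ 2 : ℝ) : ℂ) * gradForm ι Δ H v v := by
  -- Moving `x` across the form turns the left side into the form of `v` and `x*x · v`, which is
  -- linear in the action of `x*x` and expands to the matrix in `bound`.
  rw [← star_star x, gradForm_leftOp_left ι Δ H h.star_map, star_star,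
    ← LinearMap.comp_apply (leftOp ι H (star x)), ← leftOp_mul, ← sub_nonneg, ← smul_eq_mul,
    ← map_smul, ← map_sub]
  obtain ⟨n, y, ξ, rfl⟩ := TensorProduct.exists_sum_tmul_eq v
  simp only [map_sum, LinearMap.sum_apply, Finset.smul_sum, ← Finset.sum_sub_distrib, map_sub,
    map_smul, leftOp_tmul, gradForm_tmul]
  rw [Finset.sum_comm]
  refine (h.bound x n y ξ).trans_eq
    (Finset.sum_congr rfl fun i _ => Finset.sum_congr rfl fun j _ => ?_)
  simp only [map_sub, map_smul, map_mul, sub_apply, smul_apply, mul_apply_eq_comp, inner_sub_right,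
    inner_smul_right, smul_eq_mul]

theorem IsPositiveGradient.norm_leftOp_le (h : IsPositiveGradient ι Δ H) (x : S)
    (v : PreHilb (gradForm ι Δ H)) :
    ‖toPre (gradForm ι Δ H) (leftOp ι H x ((toPre _).symm v))‖ ≤ ‖ι x‖ * ‖v‖ := by
  rw [← sq_le_sq₀ (norm_nonneg _) (by positivity), mul_pow, ← Complex.real_le_real]
  have h1 := h.gradForm_leftOp_le x ((toPre _).symm v)
  rw [← inner_pre h.gradForm_nonneg v v] at h1
  have h2 := inner_pre h.gradForm_nonneg (toPre (gradForm ι Δ H) (leftOp ι H x ((toPre _).symm v)))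
    (toPre (gradForm ι Δ H) (leftOp ι H x ((toPre _).symm v)))
  simp only [LinearEquiv.symm_apply_apply] at h2
  rw [← h2, inner_self_eq_norm_sq_to_K, inner_self_eq_norm_sq_to_K] at h1
  simpa using h1

/-- The formula for the action makes sense only for `x` in `S`. The bound by `‖ι x‖`, the norm of
`A`, is what allows extension to the closure. -/
theorem IsPositiveGradient.exists_left (h : IsPositiveGradient ι Δ H)
    (hι : DenseRange ι) :
    ∃ l : A →⋆ₙₐ[ℂ] (GradHilb ι Δ H →L[ℂ] GradHilb ι Δ H), ∀ (x : S) (v : S ⊗[ℂ] H.carrier),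
      l (ι x) (toHilb (gradForm ι Δ H) v) = toHilb (gradForm ι Δ H) (leftOp ι H x v) := by
  let ρ (x : S) : PreHilb (gradForm ι Δ H) →L[ℂ] PreHilb (gradForm ι Δ H) :=
    ((toPre (gradForm ι Δ H)).toLinearMap ∘ₗ leftOp ι H x ∘ₗ
      (toPre (gradForm ι Δ H)).symm.toLinearMap).mkContinuous ‖ι x‖ (h.norm_leftOp_le x)
  let φ := completionRep ρ (fun s t => by ext v; simp [ρ, leftOp_add])
    (fun c s => by ext v; simp [ρ, leftOp_smul]) (fun s t => by ext v; simp [ρ, leftOp_mul])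
    (fun s u v => by
      rw [inner_pre h.gradForm_nonneg, inner_pre h.gradForm_nonneg]
      simpa [ρ] using gradForm_leftOp_left ι Δ H h.star_map s _ _)
  have hφ (x : S) (v : PreHilb (gradForm ι Δ H)) : φ x v = ((ρ x v : PreHilb _) : GradHilb ι Δ H) :=
    ContinuousLinearMap.completion_apply_coe (ρ x) v
  have hb (x : S) : ‖φ x‖ ≤ ‖ι x‖ := by
    refine ContinuousLinearMap.opNorm_le_bound _ (norm_nonneg _) fun v => ?_
    induction v using UniformSpace.Completion.induction_on with
    | hp => exact isClosed_le (by fun_prop) (by fun_prop)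
    | ih v =>
      rw [hφ, UniformSpace.Completion.norm_coe, UniformSpace.Completion.norm_coe]
      exact h.norm_leftOp_le x v
  obtain ⟨l, hl⟩ := exists_extension_of_dense ι hι φ hb
  exact ⟨l, fun x v => by rw [hl]; exact hφ x (toPre _ v)⟩

/-- All of `Aᵐᵒᵖ` already acts on `S ⊗ H` through `H`, so nothing has to be extended in `t`. The
adjoint relation holds because the two actions on `H` commute, and boundedness is automatic for
adjointable actions of a C⋆-algebra. -/
theorem IsPositiveGradient.exists_right (h : IsPositiveGradient ι Δ H) :
    ∃ r : Aᵐᵒᵖ →⋆ₙₐ[ℂ] (GradHilb ι Δ H →L[ℂ] GradHilb ι Δ H),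
      ∀ (t : Aᵐᵒᵖ) (v : S ⊗[ℂ] H.carrier),
        r t (toHilb (gradForm ι Δ H) v) = toHilb (gradForm ι Δ H) (rightOp H t v) := by
  let R : Aᵐᵒᵖ →ₙₐ[ℂ] Module.End ℂ (PreHilb (gradForm ι Δ H)) :=
    { toFun t := (toPre (gradForm ι Δ H)).toLinearMap ∘ₗ rightOp H t ∘ₗ
        (toPre (gradForm ι Δ H)).symm.toLinearMap
      map_smul' c t := rightOp_smul H c t
      map_zero' := by
        have := rightOp_smul (S := S) H 0 0
        rw [zero_smul, zero_smul] at this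
        exact this
      map_add' s t := rightOp_add H s t
      map_mul' s t := rightOp_mul H s t }
  have hR (t : Aᵐᵒᵖ) (u v : PreHilb (gradForm ι Δ H)) : ⟪R (star t) u, v⟫_ℂ = ⟪u, R t v⟫_ℂ := by
    rw [inner_pre h.gradForm_nonneg, inner_pre h.gradForm_nonneg]
    exact gradForm_rightOp_left ι Δ H t _ _
  let ρ (t : Aᵐᵒᵖ) : PreHilb (gradForm ι Δ H) →L[ℂ] PreHilb (gradForm ι Δ H) :=
    (R t).mkContinuous ‖t‖ (norm_le_of_adjointable R hR t)
  refine ⟨completionRep ρ (fun s t => by ext v; simp [ρ]) (fun c s => by ext v; simp [ρ])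
    (fun s t => by ext v; simp [ρ]) hR, fun t v => ?_⟩
  exact ContinuousLinearMap.completion_apply_coe (ρ t) (toPre _ v)

set_option maxHeartbeats 1000000 in
theorem IsPositiveGradient.isGradAction (h : IsPositiveGradient ι Δ H)
    (hι : DenseRange ι) :
    IsGradAction ι Δ H (gradAction ι Δ H).1 (gradAction ι Δ H).2 := by
  have hex : ∃ p : (A →⋆ₙₐ[ℂ] (GradHilb ι Δ H →L[ℂ] GradHilb ι Δ H)) ×
      (Aᵐᵒᵖ →⋆ₙₐ[ℂ] (GradHilb ι Δ H →L[ℂ] GradHilb ι Δ H)), IsGradAction ι Δ H p.1 p.2 := by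
    obtain ⟨l, hl⟩ := h.exists_left hι
    obtain ⟨r, hr⟩ := h.exists_right
    refine ⟨(l, r), fun s t v => ?_, fun x y ξ => ?_, fun x y ξ => ?_⟩
    · refine apply_comm_of_dense hι l (r t) (denseRange_toHilb (gradForm ι Δ H)) (fun x w => ?_) s v
      exact (((congrArg (l (ι x)) (hr t w)).trans (hl x _)).trans
        (congrArg _ (leftOp_rightOp ι H x t w))).trans
        (((congrArg (r t) (hl x w)).trans (hr t _))).symm
    · have e := hl x (y ⊗ₜ ξ)
      rw [leftOp_tmul] at e
      exact e.trans (map_sub (toHilb (gradForm ι Δ H)) _ _)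
    · have e := hr (MulOpposite.op (ι x)) (y ⊗ₜ ξ)
      rw [rightOp_tmul] at e
      exact e
  -- Existence rules out the default value `0` in the definition.
  unfold gradAction
  rw [dif_pos hex]
  exact hex.choose_spec

end Action

theorem sum_inner_sum_nonneg {K : Type*} [NormedAddCommGroup K] [InnerProductSpace ℂ K]
    {n : ℕ} (v : Fin n → K) : 0 ≤ ∑ i, ∑ j, ⟪v i, v j⟫_ℂ := by
  have : ∑ i, ∑ j, ⟪v i, v j⟫_ℂ = ⟪∑ i, v i, ∑ j, v j⟫_ℂ := by
    rw [sum_inner]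
    exact Finset.sum_congr rfl fun i _ => (inner_sum _ _ _).symm
  rw [this, inner_self_eq_norm_sq_to_K]
  positivity

/-! ### Completely positive maps and the Stinespring form. -/

section CP

variable {K : Type u} [NormedAddCommGroup K] [InnerProductSpace ℂ K] [CompleteSpace K]
  {M : VonNeumannAlgebra K}

theorem Elt.op_injective : Function.Injective (Elt.op (M := M)) :=
  Subtype.val_injective

theorem Elt.inner_op_star_mul (x y : Elt M) (ξ η : K) :
    ⟪ξ, Elt.op (star x * y) η⟫_ℂ = ⟪Elt.op x ξ, Elt.op y η⟫_ℂ := by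
  rw [map_mul, map_star, ContinuousLinearMap.star_eq_adjoint, mul_apply_eq_comp,
    ContinuousLinearMap.adjoint_inner_right]

/-- Before `Φ` is applied, the matrix is the Gram matrix `(d b_i)*(d b_j)`. -/
theorem IsCompletelyPositive.conj_nonneg {Φ : Elt M →ₗ[ℂ] Elt M} (hΦ : IsCompletelyPositive Φ)
    (d : Elt M) (n : ℕ) (b : Fin n → Elt M) (ξ : Fin n → K) :
    0 ≤ ∑ i, ∑ j, ⟪ξ i, Elt.op (Φ (star (b i) * (star d * d) * b j)) (ξ j)⟫_ℂ := by
  refine hΦ n (fun i j => star (b i) * (star d * d) * b j) (fun η => ?_) ξ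
  have h (i j : Fin n) : ⟪η i, Elt.op (star (b i) * (star d * d) * b j) (η j)⟫_ℂ =
      ⟪Elt.op (d * b i) (η i), Elt.op (d * b j) (η j)⟫_ℂ := by
    rw [← Elt.inner_op_star_mul, star_mul]
    simp only [mul_assoc]
  simp only [h]
  exact sum_inner_sum_nonneg _

/-- The form of the vectors `y ⊗ ξ - 1 ⊗ yξ` in the Stinespring dilation of `Φ`, weighted
by `c`. -/
noncomputable def dilationForm (Φ : Elt M →ₗ[ℂ] Elt M) (c x y : Elt M) : Elt M :=
  Φ (star x * c * y) - Φ (star x * c) * y - star x * Φ (c * y) + star x * Φ c * y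

theorem IsCompletelyPositive.dilationForm_nonneg {Φ : Elt M →ₗ[ℂ] Elt M}
    (hΦ : IsCompletelyPositive Φ) (d : Elt M) (n : ℕ) (y : Fin n → Elt M) (ξ : Fin n → K) :
    0 ≤ ∑ i, ∑ j, ⟪ξ i, Elt.op (dilationForm Φ (star d * d) (y i) (y j)) (ξ j)⟫_ℂ := by
  -- The extra entry `-1`, paired with `∑ y_i ξ_i`, collects all the terms `-1 ⊗ y_i ξ_i`.
  have h := hΦ.conj_nonneg d (n + 1) (Fin.cons (-1) y) (Fin.cons (∑ i, Elt.op (y i) (ξ i)) ξ)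
  refine h.trans_eq ?_
  simp only [Fin.sum_univ_succ, Fin.cons_zero, Fin.cons_succ, star_neg, star_one, neg_mul,
    one_mul, mul_neg, mul_one,
    map_neg, neg_apply, inner_neg_right, dilationForm, map_add, map_sub, add_apply,
    sub_apply, inner_add_right, inner_sub_right, Finset.sum_add_distrib, Finset.sum_sub_distrib,
    Finset.sum_neg_distrib]
  have e1 : ∑ i, ∑ j, ⟪ξ i, Elt.op (Φ (star (y i) * (star d * d)) * y j) (ξ j)⟫_ℂ =
      ∑ i, ⟪ξ i, Elt.op (Φ (star (y i) * (star d * d))) (∑ j, Elt.op (y j) (ξ j))⟫_ℂ := by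
    simp
  have e2 : ∑ i, ∑ j, ⟪ξ i, Elt.op (star (y i) * Φ (star d * d * y j)) (ξ j)⟫_ℂ =
      ∑ j, ⟪∑ i, Elt.op (y i) (ξ i), Elt.op (Φ (star d * d * y j)) (ξ j)⟫_ℂ := by
    rw [Finset.sum_comm]
    simp only [Elt.inner_op_star_mul, sum_inner]
  have e3 : ∑ i, ∑ j, ⟪ξ i, Elt.op (star (y i) * Φ (star d * d) * y j) (ξ j)⟫_ℂ =
      ⟪∑ i, Elt.op (y i) (ξ i), Elt.op (Φ (star d * d)) (∑ j, Elt.op (y j) (ξ j))⟫_ℂ := by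
    rw [sum_inner]
    refine Finset.sum_congr rfl fun i _ => ?_
    rw [map_sum, inner_sum]
    refine Finset.sum_congr rfl fun j _ => ?_
    rw [mul_assoc, Elt.inner_op_star_mul, map_mul, mul_apply_eq_comp]
  rw [e1, e2, e3]
  ring

theorem Elt.op_isPositive_iff (x : Elt M) :
    (Elt.op x).IsPositive ↔ ∀ ξ, 0 ≤ ⟪ξ, Elt.op x ξ⟫_ℂ :=
  ⟨fun h ξ => h.inner_nonneg_right ξ, isPositive_of_inner_nonneg⟩

theorem IsCompletelyPositive.map_star_mul_self {Φ : Elt M →ₗ[ℂ] Elt M}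
    (hΦ : IsCompletelyPositive Φ) (x : Elt M) : IsSelfAdjoint (Φ (star x * x)) := by
  have h : (Elt.op (Φ (star x * x))).IsPositive := by
    rw [Elt.op_isPositive_iff]
    intro ξ
    simpa using hΦ.conj_nonneg x 1 (fun _ => 1) (fun _ => ξ)
  apply Elt.op_injective
  rw [map_star]
  exact h.isSelfAdjoint

/-- Polarisation: self-adjointness of `Φ((x + c)*(x + c))` makes `c Φ(x*) + c̄ Φ(x)` self-adjoint,
and the cases `c = 1` and `c = i` separate the two terms. -/
theorem IsCompletelyPositive.map_star {Φ : Elt M →ₗ[ℂ] Elt M} (hΦ : IsCompletelyPositive Φ)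
    (x : Elt M) : Φ (star x) = star (Φ x) := by
  have h (c : ℂ) := (hΦ.map_star_mul_self (x + c • 1)).star_eq
  have h0 := (hΦ.map_star_mul_self x).star_eq
  have h1 := (hΦ.map_star_mul_self 1).star_eq
  have e (c : ℂ) : c • Φ (star x) + (starRingEnd ℂ) c • Φ x =
      (starRingEnd ℂ) c • star (Φ (star x)) + c • star (Φ x) := by
    have := h c
    simp only [star_add, star_smul, star_one, add_mul, mul_add, smul_mul_assoc, mul_smul_comm,
      one_mul, mul_one, map_add, map_smul, Complex.star_def, Complex.conj_conj, h0] at this h1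
    rw [h1, smul_add, smul_add, smul_comm c ((starRingEnd ℂ) c) (Φ 1), ← sub_eq_zero] at this
    rw [← sub_eq_zero, ← neg_eq_zero, ← this]
    abel
  have e1 := e 1
  have eI := congrArg (Complex.I • ·) (e Complex.I)
  simp only [map_one, one_smul, Complex.conj_I, smul_add, smul_neg, smul_smul,
    Complex.I_mul_I, neg_neg, neg_smul] at e1 eI
  have h2 : (2 : ℂ) • Φ (star x) = (2 : ℂ) • star (Φ x) := by
    calc (2 : ℂ) • Φ (star x) = (Φ (star x) + Φ x) - (-Φ (star x) + Φ x) := by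
          rw [two_smul]; abel
      _ = (2 : ℂ) • star (Φ x) := by rw [e1, eI, two_smul]; abel
  exact smul_right_injective _ two_ne_zero h2

end CP

/-! ### Contractivity of the semi-group on `L₂`. -/

namespace QMS

variable {K : Type u} [NormedAddCommGroup K] [InnerProductSpace ℂ K] [CompleteSpace K]
  {M : VonNeumannAlgebra K} {τ : FiniteTrace M} (P : QMS τ)

/-- The Kadison–Schwarz inequality `Φ(x)*Φ(x) ≤ Φ(x*x)`, followed by invariance of the trace. -/
theorem schwarz (t : ℝ≥0) (x : Elt M) :
    τ.τ (star (P.Φ t x) * P.Φ t x) ≤ τ.τ (star x * x) := by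
  have h := τ.pos (P.Φ t (star x * x) - star (P.Φ t x) * P.Φ t x) (by
    rw [Elt.op_isPositive_iff]
    intro ξ
    -- This is the squared length of `x ⊗ ξ - 1 ⊗ Φ(x)ξ` in the dilation.
    have := (P.cp t).conj_nonneg 1 2 ![x, -1] ![ξ, Elt.op (P.Φ t x) ξ]
    simp [Fin.sum_univ_two, P.unital] at this
    simpa [inner_sub_right, (P.cp t).map_star] using this)
  rw [map_sub, P.trace, sub_nonneg] at h
  exact h

theorem norm_toL2_le (t : ℝ≥0) (x : Elt M) : ‖τ.toL2 (P.Φ t x)‖ ≤ ‖τ.toL2 x‖ := by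
  have h := P.schwarz t x
  rw [← τ.inner_toL2, ← τ.inner_toL2, inner_self_eq_norm_sq_to_K, inner_self_eq_norm_sq_to_K] at h
  rw [← sq_le_sq₀ (norm_nonneg _) (norm_nonneg _), ← Complex.real_le_real]
  simpa using h

end QMS

theorem FiniteTrace.norm_toL2_le_norm {K : Type u} [NormedAddCommGroup K] [InnerProductSpace ℂ K]
    [CompleteSpace K] {M : VonNeumannAlgebra K} (τ : FiniteTrace M) (x : Elt M) :
    ‖τ.toL2 x‖ ≤ ‖τ.Ω‖ * ‖x‖ := by
  have e : τ.toL2 x = (τ.leftPre x).completion τ.Ω := by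
    refine ((ContinuousLinearMap.completion_apply_coe (τ.leftPre x) (toPre τ.form 1)).trans ?_).symm
    simp [FiniteTrace.leftPre]
    rfl
  have h : ‖(τ.leftPre x).completion τ.Ω‖ ≤ ‖x‖ * ‖τ.Ω‖ := by
    change ‖(τ.leftPre x).completion ((toPre τ.form 1 : PreHilb τ.form) : τ.L2)‖ ≤
      ‖x‖ * ‖((toPre τ.form 1 : PreHilb τ.form) : τ.L2)‖
    rw [ContinuousLinearMap.completion_apply_coe, UniformSpace.Completion.norm_coe,
      UniformSpace.Completion.norm_coe]
    exact ContinuousLinearMap.le_of_opNorm_le _ (LinearMap.mkContinuous_norm_le _ (norm_nonneg _) _) _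
  rw [e, mul_comm]
  exact h

variable {K : Type u} [NormedAddCommGroup K] [InnerProductSpace ℂ K] [CompleteSpace K]
  {M : VonNeumannAlgebra K} {τ : FiniteTrace M} {P : QMS τ}

/-- `toL2` as a bounded operator. -/
noncomputable def FiniteTrace.toL2CLM (τ : FiniteTrace M) : Elt M →L[ℂ] τ.L2 :=
  τ.toL2.mkContinuous ‖τ.Ω‖ τ.norm_toL2_le_norm

/-! ### The generator as a norm derivative. -/

namespace CoreAlgebra

variable (C : CoreAlgebra P)

/-- The semi-group has right derivative `-Φ_s(Δ a)` in `L₂`. -/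
theorem hasDerivWithinAt_toL2 (a : C.alg) {s : ℝ} (hs : 0 ≤ s) :
    HasDerivWithinAt (fun r : ℝ => τ.toL2 (P.Φ r.toNNReal a))
      (-τ.toL2 (P.Φ s.toNNReal (C.delta a : Elt M))) (Set.Ici s) s := by
  rw [← hasDerivWithinAt_Ioi_iff_Ici, hasDerivWithinAt_iff_tendsto_slope' (by simp)]
  have hshift : Filter.Tendsto (fun r : ℝ => (r - s).toNNReal) (𝓝[>] s) (𝓝[>] 0) := by
    refine tendsto_nhdsWithin_iff.2 ⟨?_, ?_⟩
    · have : Continuous fun r : ℝ => (r - s).toNNReal := by fun_prop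
      have h := this.tendsto s
      simp only [sub_self, Real.toNNReal_zero] at h
      exact h.mono_left nhdsWithin_le_nhds
    · filter_upwards [self_mem_nhdsWithin] with r hr
      simpa using hr
  have h := (C.delta_spec a).comp hshift
  rw [tendsto_iff_norm_sub_tendsto_zero] at h ⊢
  refine squeeze_zero' (Filter.Eventually.of_forall fun _ => norm_nonneg _) ?_ h
  filter_upwards [self_mem_nhdsWithin] with r hr
  have hr : s < r := hr
  have hsum : r.toNNReal = s.toNNReal + (r - s).toNNReal := by
    rw [← Real.toNNReal_add hs (by linarith)]
    congr 1
    ring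
  have hc : ((((r - s).toNNReal : ℝ≥0) : ℂ))⁻¹ = (((r - s)⁻¹ : ℝ) : ℂ) := by
    have h0 := Real.coe_toNNReal (r - s) (by linarith)
    rw [Complex.ofReal_inv]
    exact congrArg (fun x : ℝ => (x : ℂ)⁻¹) h0
  -- By the semi-group law the error at `s` is, up to sign, `Φ_s` of the error at `0`, and `Φ_s`
  -- contracts the `L₂` norm.
  have e : slope (fun r : ℝ => τ.toL2 (P.Φ r.toNNReal (a : Elt M))) s r -
      -τ.toL2 (P.Φ s.toNNReal (C.delta a : Elt M)) = -τ.toL2 (P.Φ s.toNNReal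
        (((((r - s).toNNReal : ℝ≥0) : ℂ))⁻¹ • ((a : Elt M) - P.Φ (r - s).toNNReal (a : Elt M)) -
          (C.delta a : Elt M))) := by
    rw [slope_def_module, hsum, P.add, LinearMap.comp_apply, hc, ← Complex.coe_smul]
    simp only [map_sub, map_smul, smul_sub]
    abel
  rw [e, norm_neg]
  refine (P.norm_toL2_le _ _).trans_eq ?_
  simp only [map_sub, map_smul, Function.comp_apply]

/-- `a - Φ_t(a) = ∫₀ᵗ Φ_s(Δ a) ds` in `M`. -/
theorem Φ_add_integral (a : C.alg) {t : ℝ} (ht : 0 ≤ t) :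
    P.Φ t.toNNReal (a : Elt M) + ∫ s in (0 : ℝ)..t, P.Φ s.toNNReal (C.delta a : Elt M) = a := by
  have hcont : Continuous fun s : ℝ => P.Φ s.toNNReal (C.delta a : Elt M) :=
    (C.norm_cont (C.delta a)).comp continuous_real_toNNReal
  have hcont' : Continuous fun s : ℝ => P.Φ s.toNNReal (a : Elt M) :=
    (C.norm_cont a).comp continuous_real_toNNReal
  let F (t : ℝ) : Elt M := ∫ s in (0 : ℝ)..t, P.Φ s.toNNReal (C.delta a : Elt M)
  have hF (t : ℝ) : HasDerivAt F (P.Φ t.toNNReal (C.delta a : Elt M)) t :=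
    (hcont.integral_hasStrictDerivAt 0 t).hasDerivAt
  have hFc : Continuous F := continuous_iff_continuousAt.2 fun t => (hF t).continuousAt
  -- Only a right derivative in `L₂` is available for the semi-group. With continuity this suffices
  -- for constancy, and injectivity of `M → L₂` brings the identity back to `M`.
  have hder (s : ℝ) (hs : s ∈ Set.Ico 0 t) : HasDerivWithinAt
      (fun s => τ.toL2CLM (P.Φ s.toNNReal (a : Elt M) + F s)) 0 (Set.Ici s) s := by
    have h1 := C.hasDerivWithinAt_toL2 a hs.1
    have h2 : HasDerivAt (fun s => τ.toL2CLM (F s)) _ s :=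
      ((τ.toL2CLM.restrictScalars ℝ).hasFDerivAt.comp_hasDerivAt s (hF s))
    have h3 := h1.add h2.hasDerivWithinAt
    refine (h3.congr_deriv (neg_add_cancel _)).congr_of_eventuallyEq
      (Filter.Eventually.of_forall fun r => map_add _ _ _) (map_add _ _ _)
  have h := constant_of_has_deriv_right_zero
    ((τ.toL2CLM.continuous.comp (hcont'.add hFc)).continuousOn) hder t ⟨ht, le_rfl⟩
  have h := τ.toL2_injective h
  simpa [F, P.zero] using h

/-- On `𝒜`, `Δ` is the derivative of the semi-group in norm. -/
theorem tendsto_delta (a : C.alg) :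
    Filter.Tendsto (fun t : ℝ≥0 => ((t : ℂ)⁻¹) • ((a : Elt M) - P.Φ t a))
      (𝓝[>] 0) (𝓝 (C.delta a : Elt M)) := by
  have hcont : Continuous fun s : ℝ => P.Φ s.toNNReal (C.delta a : Elt M) :=
    (C.norm_cont (C.delta a)).comp continuous_real_toNNReal
  -- The difference quotient is the average of `Φ_s(Δ a)` over `[0, t]`, whose integrand is norm
  -- continuous with value `Δ a` at `0`.
  have h := ((hcont.integral_hasStrictDerivAt 0 0).hasDerivAt.hasDerivWithinAt (s := Set.Ioi 0))
  rw [hasDerivWithinAt_iff_tendsto_slope' (by simp)] at h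
  have hcoe : Filter.Tendsto (fun t : ℝ≥0 => (t : ℝ)) (𝓝[>] 0) (𝓝[>] 0) := by
    refine tendsto_nhdsWithin_iff.2 ⟨?_, ?_⟩
    · exact (NNReal.continuous_coe.tendsto 0).mono_left nhdsWithin_le_nhds
    · filter_upwards [self_mem_nhdsWithin] with r hr
      simpa using hr
  have h := h.comp hcoe
  rw [Real.toNNReal_zero, P.zero, LinearMap.id_apply] at h
  refine h.congr fun t => ?_
  have e := C.Φ_add_integral a t.coe_nonneg
  rw [Real.toNNReal_coe] at e
  rw [Function.comp_apply, slope_def_module, intervalIntegral.integral_same, sub_zero, sub_zero]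
  rw [← eq_sub_iff_add_eq'] at e
  rw [e, ← Complex.coe_smul, Complex.ofReal_inv]

theorem delta_star (a : C.alg) : C.delta (star a) = star (C.delta a) := by
  refine Subtype.ext (tendsto_nhds_unique (C.tendsto_delta (star a)) ?_)
  refine ((C.tendsto_delta a).star).congr fun t => ?_
  have : ((star a : C.alg) : Elt M) = star (a : Elt M) := rfl
  rw [this, (P.cp t).map_star, star_smul, star_sub]
  simp

end CoreAlgebra

/-- Since `Φ 1 = 1`, the dilation form can be written with `Φ` occurring only in differences `a -
Φ(a)`. With `c = 1/t` these are the difference quotients that converge to `Δ(a)`. -/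
theorem smul_dilationForm {Φ : Elt M →ₗ[ℂ] Elt M} (hΦ : Φ 1 = 1) (c r : ℂ) (w x y : Elt M) :
    c • dilationForm Φ (r • 1 - w) x y =
      r • (c • (star x - Φ (star x)) * y + star x * c • (y - Φ y) -
        c • (star x * y - Φ (star x * y))) -
      (star x * c • (w * y - Φ (w * y)) - c • (star x * (w * y) - Φ (star x * (w * y))) -
        (star x * c • (w - Φ w) - c • (star x * w - Φ (star x * w))) * y) := by
  simp only [dilationForm, mul_sub, sub_mul, mul_smul_comm, smul_mul_assoc, mul_one, one_mul,
    map_sub, map_smul, hΦ, smul_sub, smul_add, mul_assoc, smul_comm c r]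
  abel

theorem Elt.continuous_op : Continuous (Elt.op (M := M)) :=
  AddMonoidHomClass.continuous_of_bound Elt.op 1 fun x => (one_mul ‖x‖).ge

/-! ### Positivity of the gradient form and the bimodules `L₂(M)_{∇⁽ⁿ⁾}`. -/

namespace CoreAlgebra

variable (C : CoreAlgebra P)

/-- The combination of values of the gradient form that is the derivative of the form of the
Stinespring dilation with weight `r - x* x`. -/
noncomputable def weightedΓ (r : ℂ) (x y z : C.alg) : C.alg :=
  r • Γ C.delta z y - (Γ C.delta (star x * x * z) y - Γ C.delta (star x * x) y * z)

theorem tendsto_weightedΓ (r : ℂ) (x y z : C.alg) :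
    Filter.Tendsto (fun t : ℝ≥0 => (1 / 2 : ℂ) • ((t : ℂ)⁻¹ • dilationForm (P.Φ t)
      (r • 1 - star (x : Elt M) * (x : Elt M)) (y : Elt M) (z : Elt M)))
      (𝓝[>] 0) (𝓝 (C.weightedΓ r x y z : Elt M)) := by
  have e : (C.weightedΓ r x y z : Elt M) = (1 / 2 : ℂ) •
      (r • ((C.delta (star y) : Elt M) * z + star (y : Elt M) * (C.delta z : Elt M) -
        (C.delta (star y * z) : Elt M)) -
      (star (y : Elt M) * (C.delta (star x * x * z) : Elt M) -
        (C.delta (star y * (star x * x * z)) : Elt M) -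
        (star (y : Elt M) * (C.delta (star x * x) : Elt M) -
          (C.delta (star y * (star x * x)) : Elt M)) * z)) := by
    -- The terms `Δ(y)* x*x z` of the last two gradient forms cancel.
    have : C.weightedΓ r x y z = (1 / 2 : ℂ) •
      (r • (C.delta (star y) * z + star y * C.delta z - C.delta (star y * z)) -
      (star y * C.delta (star x * x * z) - C.delta (star y * (star x * x * z)) -
        (star y * C.delta (star x * x) - C.delta (star y * (star x * x))) * z)) := by
      simp only [weightedΓ, Γ, C.delta_star, smul_mul_assoc, smul_sub, smul_add, add_mul, sub_mul,
        mul_assoc, smul_comm r (1 / 2 : ℂ)]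
      abel
    rw [this]
    rfl
  rw [e]
  have h (a : C.alg) := C.tendsto_delta a
  refine Filter.Tendsto.const_smul (Filter.Tendsto.congr
    (fun t => (smul_dilationForm (P.unital t) _ r _ _ _).symm) ?_) _
  refine Filter.Tendsto.sub (Filter.Tendsto.const_smul (Filter.Tendsto.sub (Filter.Tendsto.add
    ((h (star y)).mul_const _) ((h z).const_mul _)) (h (star y * z))) _)
    (Filter.Tendsto.sub (Filter.Tendsto.sub ((h (star x * x * z)).const_mul _)
      (h (star y * (star x * x * z)))) (Filter.Tendsto.mul_const _ (Filter.Tendsto.sub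
        ((h (star x * x)).const_mul _) (h (star y * (star x * x))))))

/-- A limit of nonnegative dilation forms. The square root `d` of the weight need only lie in `M`,
because `Δ` is never applied to it. -/
theorem weightedΓ_nonneg (r : ℂ) (x : C.alg) (d : Elt M)
    (hd : star d * d = r • 1 - star (x : Elt M) * (x : Elt M)) (n : ℕ) (y : Fin n → C.alg)
    (ξ : Fin n → K) :
    0 ≤ ∑ i, ∑ j, ⟪ξ i, Elt.op (C.weightedΓ r x (y i) (y j) : Elt M) (ξ j)⟫_ℂ := by
  refine ge_of_tendsto' (x := 𝓝[>] (0 : ℝ≥0)) (tendsto_finsetSum _ fun i _ =>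
    tendsto_finsetSum _ fun j _ => ?_) (fun t => ?_)
    (f := fun t : ℝ≥0 => ∑ i, ∑ j, ⟪ξ i, Elt.op ((1 / 2 : ℂ) • ((t : ℂ)⁻¹ • dilationForm (P.Φ t)
      (r • 1 - star (x : Elt M) * (x : Elt M)) (y i : Elt M) (y j : Elt M))) (ξ j)⟫_ℂ)
  · have hc : Continuous fun a : Elt M => ⟪ξ i, Elt.op a (ξ j)⟫_ℂ := by
      have := Elt.continuous_op (M := M)
      fun_prop
    exact (hc.tendsto _).comp (C.tendsto_weightedΓ r x (y i) (y j))
  · have h := (P.cp t).dilationForm_nonneg d n (fun i => (y i : Elt M)) ξ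
    rw [hd] at h
    simp only [map_smul, smul_apply, inner_smul_right, ← Finset.mul_sum]
    have h1 : (0 : ℂ) ≤ 1 / 2 := by
      rw [Complex.le_def]
      norm_num
    have h2 : (0 : ℂ) ≤ (t : ℂ)⁻¹ := by
      have := Complex.zero_le_real.2 (inv_nonneg.2 t.coe_nonneg)
      rwa [Complex.ofReal_inv] at this
    exact mul_nonneg h1 (mul_nonneg h2 h)

noncomputable instance : NonUnitalCStarAlgebra C.A :=
  have : IsClosed (C.alg.topologicalClosure : Set (Elt M)) :=
    C.alg.isClosed_topologicalClosure
  NonUnitalStarSubalgebra.nonUnitalCStarAlgebra C.alg.topologicalClosure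

/-- The representation of `A` on `K`. -/
noncomputable def repr : C.A →⋆ₙₐ[ℂ] (K →L[ℂ] K) where
  toFun a := Elt.op (a : Elt M)
  map_smul' _ _ := rfl
  map_zero' := rfl
  map_add' _ _ := rfl
  map_mul' _ _ := rfl
  map_star' _ := rfl

theorem repr_injective : Function.Injective C.repr :=
  Elt.op_injective.comp Subtype.val_injective

theorem denseRange_incl : DenseRange C.incl := by
  intro a
  rw [closure_subtype]
  have h : (a : Elt M) ∈ closure (C.alg : Set (Elt M)) := a.2
  convert h
  ext b
  constructor
  · rintro ⟨_, ⟨c, rfl⟩, rfl⟩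
    exact c.2
  · intro hb
    exact ⟨C.incl ⟨b, hb⟩, ⟨_, rfl⟩, rfl⟩

theorem isPositiveGradient (H : Bimod C.A) : IsPositiveGradient (A := C.A) C.incl C.delta H where
  star_map := C.delta_star
  nonneg n y ξ := by
    refine matrix_nonneg_of_injective C.repr_injective H.left
      (fun i j => C.incl (Γ C.delta (y j) (y i))) (fun η => ?_) ξ
    -- With `x = 0` and weight `1`, only `Γ` itself remains.
    have h := C.weightedΓ_nonneg 1 0 1 (by simp) n y η
    simp only [weightedΓ, one_smul, mul_zero, zero_mul, Γ, map_zero, sub_zero, smul_zero, add_zero,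
      mul_zero] at h
    exact h
  bound x n y ξ := by
    refine matrix_nonneg_of_injective C.repr_injective H.left
      (fun i j => C.incl (((‖C.incl x‖ ^ 2 : ℝ) : ℂ) • Γ C.delta (y j) (y i) -
      (Γ C.delta (star x * x * y j) (y i) - Γ C.delta (star x * x) (y i) * y j))) (fun η => ?_) ξ
    let := CStarAlgebra.spectralOrder (Elt M)
    have := CStarAlgebra.spectralOrderedRing (Elt M)
    -- This produces the weight `‖x‖² - x*x = d*d`; the norms of `x` in `A` and in `M` agree.
    have hle := CStarAlgebra.star_mul_le_algebraMap_norm_sq (a := (x : Elt M))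
    rw [← sub_nonneg, CStarAlgebra.nonneg_iff_eq_star_mul_self] at hle
    obtain ⟨d, hd⟩ := hle
    refine C.weightedΓ_nonneg _ x d ?_ n y η
    rw [← hd, IsScalarTower.algebraMap_apply ℝ ℂ (Elt M), Algebra.algebraMap_eq_smul_one]
    rfl

theorem inner_tmul (n : ℕ) (x y : C.alg) (ξ η : (C.L2Grad n).carrier) :
    ⟪C.tmul n x ξ, C.tmul n y η⟫_ℂ =
      ⟪ξ, (C.L2Grad n).left (C.incl (Γ C.delta y x)) η⟫_ℂ :=
  inner_toHilb (C.isPositiveGradient (C.L2Grad n)).gradForm_nonneg (x ⊗ₜ ξ) (y ⊗ₜ η)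

theorem left_tmul (n : ℕ) (x y : C.alg) (ξ : (C.L2Grad n).carrier) :
    (C.L2Grad (n + 1)).left (C.incl x) (C.tmul n y ξ) =
      C.tmul n (x * y) ξ - C.tmul n x ((C.L2Grad n).left (C.incl y) ξ) :=
  ((C.isPositiveGradient (C.L2Grad n)).isGradAction C.denseRange_incl).2.1 x y ξ

theorem right_tmul (n : ℕ) (x y : C.alg) (ξ : (C.L2Grad n).carrier) :
    (C.L2Grad (n + 1)).right (MulOpposite.op (C.incl x)) (C.tmul n y ξ) =
      C.tmul n y ((C.L2Grad n).right (MulOpposite.op (C.incl x)) ξ) :=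
  ((C.isPositiveGradient (C.L2Grad n)).isGradAction C.denseRange_incl).2.2 x y ξ

/-! ### The cocycle identity. -/

theorem partialMap_succ (n : ℕ) (a : Fin (n + 1) → C.alg) :
    C.partialMap (n + 1) a = C.tmul n (a 0) (C.partialMap n fun i => a i.succ) :=
  rfl

/-- In `a_0 · (a_1 ⊗_∇ ξ) = a_0a_1 ⊗_∇ ξ - a_0 ⊗_∇ a_1ξ` the first term cancels the first summand of
the alternating sum, and the second is the leading term of the right side. All other terms begin
with `a_0 ⊗_∇`, and the shift of index gives the sign. -/
theorem hochschildD_partialMap_succ (n : ℕ) (a : Fin (n + 2) → C.alg) :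
    hochschildD C.incl (C.L2Grad (n + 1)) (n + 1) (C.partialMap (n + 1)) a =
      -C.tmul n (a 0) (hochschildD C.incl (C.L2Grad n) n (C.partialMap n) fun i => a i.succ) := by
  unfold hochschildD
  simp only [partialMap_succ, left_tmul, right_tmul, Fin.sum_univ_succ, map_add, map_sum,
    map_smul]
  simp only [Fin.not_lt_zero, Fin.succ_ne_zero, if_false, if_true, Fin.castSucc_zero,
    Fin.succ_zero_eq_one, Fin.val_zero, zero_add, pow_one, neg_smul, one_smul, Fin.succ_pos,
    Fin.succ_lt_succ_iff, Fin.succ_inj, Fin.val_succ, Fin.succ_last, Fin.castSucc_succ,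
    pow_succ _ (_ + 1), mul_neg, mul_one, Finset.sum_neg_distrib, lt_self_iff_false]
  abel

theorem partialMap_mem_hochschildCocycles (n : ℕ) :
    C.partialMap n ∈ hochschildCocycles C.incl (C.L2Grad n) n := by
  intro a
  induction n with
  -- The base case is `aΩ - Ωa = 0`: both vectors are the image of `a` in `L₂`.
  | zero =>
    have h1 : (C.L2Grad 0).left (C.incl (a 0)) (C.partialMap 0 fun i => a i.succ) =
        τ.toL2 (a 0 : Elt M) := by
      refine (C.L2Bimod_left (C.incl (a 0)) 1).trans ?_
      rw [mul_one]
      rfl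
    have h2 : (C.L2Grad 0).right (MulOpposite.op (C.incl (a (Fin.last 0))))
        (C.partialMap 0 fun i => a i.castSucc) = τ.toL2 (a 0 : Elt M) := by
      refine (C.L2Bimod_right (C.incl (a 0)) 1).trans ?_
      rw [one_mul]
      rfl
    unfold hochschildD
    rw [h1, h2, Finset.univ_eq_empty, Finset.sum_empty]
    have h (v : τ.L2) : v + 0 + (-1 : ℂ) ^ (0 + 1) • v = 0 := by simp
    exact h _
  | succ n ih => rw [hochschildD_partialMap_succ, ih, map_zero, neg_zero]

/-! ### The derivation `∂_1`. -/

theorem partialMap_one (a : C.alg) : C.partialMap 1 ![a] = C.tmul 0 a τ.Ω :=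
  rfl

theorem partialMap_one_mul (a b : C.alg) : C.partialMap 1 ![a * b] =
    (C.L2Grad 1).left (C.incl a) (C.partialMap 1 ![b]) +
      (C.L2Grad 1).right (MulOpposite.op (C.incl b)) (C.partialMap 1 ![a]) := by
  have h := C.partialMap_mem_hochschildCocycles 1 ![a, b]
  have e0 : (fun i : Fin 1 => ![a, b] i.succ) = ![b] := by
    ext i; fin_cases i; rfl
  have e1 : (fun i : Fin 1 => ![a, b] i.castSucc) = ![a] := by
    ext i; fin_cases i; rfl
  have e2 : (fun i : Fin 1 => if i < 0 then ![a, b] i.castSucc else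
      if i = 0 then ![a, b] i.castSucc * ![a, b] i.succ else ![a, b] i.succ) = ![a * b] := by
    ext i; fin_cases i; rfl
  unfold hochschildD at h
  rw [Fin.sum_univ_one, e0, e1, e2] at h
  rw [← sub_eq_zero, ← neg_eq_zero, ← h]
  simp
  abel

theorem trace_delta (a : C.alg) : τ.τ (C.delta a : Elt M) = 0 := by
  have h : Filter.Tendsto (fun t : ℝ≥0 => ⟪τ.Ω, (t : ℂ)⁻¹ • (τ.toL2 (a : Elt M) -
      τ.toL2 (P.Φ t a))⟫_ℂ) (𝓝[>] 0) (𝓝 ⟪τ.Ω, τ.toL2 (C.delta a : Elt M)⟫_ℂ) :=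
    tendsto_const_nhds.inner (C.delta_spec a)
  have e (t : ℝ≥0) : ⟪τ.Ω, (t : ℂ)⁻¹ • (τ.toL2 (a : Elt M) - τ.toL2 (P.Φ t a))⟫_ℂ = 0 := by
    rw [← map_sub, ← map_smul, FiniteTrace.Ω, τ.inner_toL2, star_one, one_mul, map_smul, map_sub,
      P.trace, sub_self, smul_zero]
  simp only [e] at h
  rw [FiniteTrace.Ω, τ.inner_toL2, star_one, one_mul] at h
  exact tendsto_nhds_unique h tendsto_const_nhds

theorem trace_star_delta_mul (a b : C.alg) : τ.τ (star (C.delta a : Elt M) * (b : Elt M)) =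
    τ.τ (star (a : Elt M) * (C.delta b : Elt M)) := by
  rw [← τ.inner_toL2, ← τ.inner_toL2]
  refine tendsto_nhds_unique ((C.delta_spec a).inner tendsto_const_nhds)
    ((tendsto_const_nhds.inner (C.delta_spec b)).congr fun t => ?_)
  rw [← map_sub, ← map_sub, inner_smul_left, inner_smul_right, τ.inner_toL2, τ.inner_toL2, star_sub,
    sub_mul, mul_sub, map_sub, map_sub, ← (P.cp t).map_star, P.symm]
  simp

/-- The left side is `τ(Γ(b, a))`. Its term `τ(Δ(a*b))` vanishes by invariance of the trace, and the
other two coincide by symmetry, which absorbs the factor `1/2`. -/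
theorem inner_partialMap_one (a b : C.alg) : ⟪C.partialMap 1 ![a], C.partialMap 1 ![b]⟫_ℂ =
    ⟪τ.toL2 (a : Elt M), τ.toL2 (C.delta b : Elt M)⟫_ℂ := by
  refine (C.inner_tmul 0 a b τ.Ω τ.Ω).trans ?_
  rw [τ.inner_toL2]
  have e : (C.L2Grad 0).left (C.incl (Γ C.delta b a)) τ.Ω =
      τ.toL2 ((Γ C.delta b a : C.alg) : Elt M) := by
    refine (C.L2Bimod_left (C.incl (Γ C.delta b a)) 1).trans ?_
    rw [mul_one]
    rfl
  rw [e]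
  refine (τ.inner_toL2 1 _).trans ?_
  have e' : ((Γ C.delta b a : C.alg) : Elt M) = (1 / 2 : ℂ) •
    (star (C.delta a : Elt M) * (b : Elt M) + star (a : Elt M) * (C.delta b : Elt M) - (C.delta (star a * b) : Elt M)) := rfl
  rw [star_one, one_mul, e', map_smul, map_sub, map_add, trace_delta, trace_star_delta_mul,
    smul_eq_mul]
  ring

/-- As `⟨∂a_k, ∂b⟩ = ⟨a_kΩ, Δ(b)Ω⟩ → 0`, the vector `η` is orthogonal to the range of `∂_1`; being a
limit of vectors in that range, it is orthogonal to itself. -/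
theorem partialMap_one_closable (a : ℕ → C.alg) (η : (C.L2Grad 1).carrier)
    (ha : Filter.Tendsto (fun k => τ.toL2 (a k : Elt M)) Filter.atTop (𝓝 0))
    (hη : Filter.Tendsto (fun k => C.partialMap 1 ![a k]) Filter.atTop (𝓝 η)) : η = 0 := by
  have h (b : C.alg) : ⟪η, C.partialMap 1 ![b]⟫_ℂ = 0 := by
    have h1 : Filter.Tendsto (fun k => ⟪C.partialMap 1 ![a k], C.partialMap 1 ![b]⟫_ℂ)
        Filter.atTop (𝓝 ⟪η, C.partialMap 1 ![b]⟫_ℂ) := hη.inner tendsto_const_nhds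
    have h2 : Filter.Tendsto (fun k => ⟪τ.toL2 (a k : Elt M), τ.toL2 (C.delta b : Elt M)⟫_ℂ)
        Filter.atTop (𝓝 ⟪0, τ.toL2 (C.delta b : Elt M)⟫_ℂ) := ha.inner tendsto_const_nhds
    simp only [inner_partialMap_one] at h1
    rw [inner_zero_left] at h2
    exact tendsto_nhds_unique h1 h2
  have h3 : Filter.Tendsto (fun k => ⟪η, C.partialMap 1 ![a k]⟫_ℂ) Filter.atTop (𝓝 ⟪η, η⟫_ℂ) :=
    tendsto_const_nhds.inner hη
  simp only [h] at h3
  exact inner_self_eq_zero.1 (tendsto_nhds_unique h3 tendsto_const_nhds)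

end CoreAlgebra

end GradientCocycle

theorem mainTheorem8 {K : Type*} [NormedAddCommGroup K] [InnerProductSpace ℂ K] [CompleteSpace K]
    (M : VonNeumannAlgebra K) (τ : GradientCocycle.FiniteTrace M) (P : GradientCocycle.QMS τ)
    (C : GradientCocycle.CoreAlgebra P) :
    -- the gradient tensor products `L₂(M)_{∇⁽ⁿ⁺¹⁾} = (L₂(M)_{∇⁽ⁿ⁾})_∇` are well defined bimodules
    (∀ n : ℕ,
      (∀ (x y : C.alg) (ξ η : (C.L2Grad n).carrier),
        ⟪C.tmul n x ξ, C.tmul n y η⟫_ℂ =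
          ⟪ξ, (C.L2Grad n).left (C.incl (GradientCocycle.Γ C.delta y x)) η⟫_ℂ) ∧
      (∀ (x y : C.alg) (ξ : (C.L2Grad n).carrier),
        (C.L2Grad (n + 1)).left (C.incl x) (C.tmul n y ξ) =
          C.tmul n (x * y) ξ - C.tmul n x ((C.L2Grad n).left (C.incl y) ξ)) ∧
      (∀ (x y : C.alg) (ξ : (C.L2Grad n).carrier),
        (C.L2Grad (n + 1)).right (MulOpposite.op (C.incl x)) (C.tmul n y ξ) =
          C.tmul n y ((C.L2Grad n).right (MulOpposite.op (C.incl x)) ξ))) ∧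
    -- `∂_n` is a Hochschild `n`-cocycle
    (∀ n : ℕ, C.partialMap n ∈ GradientCocycle.hochschildCocycles C.incl (C.L2Grad n) n) ∧
    -- `∂_1(a) = a ⊗_∇ Ω_τ` is a derivation
    (∀ a : C.alg, C.partialMap 1 ![a] = C.tmul 0 a τ.Ω) ∧
    (∀ a b : C.alg, C.partialMap 1 ![a * b] =
      (C.L2Grad 1).left (C.incl a) (C.partialMap 1 ![b]) +
        (C.L2Grad 1).right (MulOpposite.op (C.incl b)) (C.partialMap 1 ![a])) ∧
    -- it is a square root of the generator, and closable
    (∀ a b : C.alg, ⟪C.partialMap 1 ![a], C.partialMap 1 ![b]⟫_ℂ =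
      ⟪τ.toL2 (a : GradientCocycle.Elt M), τ.toL2 (C.delta b : GradientCocycle.Elt M)⟫_ℂ) ∧
    (∀ (a : ℕ → C.alg) (η : (C.L2Grad 1).carrier),
      Filter.Tendsto (fun k => τ.toL2 (a k : GradientCocycle.Elt M)) Filter.atTop (𝓝 0) →
      Filter.Tendsto (fun k => C.partialMap 1 ![a k]) Filter.atTop (𝓝 η) → η = 0) := by

  exact ⟨fun n => ⟨C.inner_tmul n, C.left_tmul n, C.right_tmul n⟩,
    C.partialMap_mem_hochschildCocycles, C.partialMap_one, C.partialMap_one_mul,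
    C.inner_partialMap_one, C.partialMap_one_closable⟩
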